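/- For a bounded convex region $A\subset\mathbb R^2$ with nonempty interior let $\mathrm{ar}(A)=\mathrm{diam}(A)^2/\mathrm{area}(A)$. A finite rooted tree $T$ is \emph{properly weighted} by $w$ if every node $\nu$ has weight $w(\nu)>0$, the weight of every internal node is the sum of the weights of its children, and $w(\mathrm{root}(T))=1$. A \emph{polygonal partition} for $(T,w)$ assigns to each node $\nu$ a convex polygon $P(\nu)$ of area $w(\nu)$ such that $P(\mathrm{root}(T))$ is the unit square and, for each internal node $\nu$, the polygons of the children of $\nu$ have union $P(\nu)$ and pairwise disjoint interiors. Its aspect ratio is the maximum of $\mathrm{ar}(P(\nu))$ over all nodes $\nu$. The depth of $T$ is the maximum number of edges on a path from the root to a node. The \emph{greedy method} runs as follows. (i) Transform $T$ into a binary tree $T'$, starting at the root and recursing. At a node $\nu$ with at most two children, recurse on the children. At a node $\nu$ with at least three children, let $\mu$ be a child whose subtree has the largest number of nodes. Split the other children into two nonempty sets $C_1,C_2$ so that, for $i=1,2$, the subtrees rooted at the nodes of $C_i$ together have fewer than half as many nodes as the subtree rooted at $\nu$ (including $\nu$). Replace the children of $\nu$ by two new nodes $\nu_1,\nu_2$,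 where $\nu_1$ has the set of children $C_1$, and $\nu_2$ has as children $\mu$ and a new node $\nu_3$ with the set of children $C_2$; then recurse on $\nu_1,\mu,\nu_3$. The weight of a new node is the sum of the weights of the leaves below it. Finally, suppress each node with exactly one child; such a node receives the same polygon as its child. (ii) Assign the unit square to the root of $T'$. Recursively, for each node of $T'$ with two children, cut its polygon by a straight line into two pieces whose areas are the weights of the two children. Among all such cuts choose one that minimizes the larger of the aspect ratios of the two pieces, and assign the pieces to the children. Keep the polygons of the nodes of $T$. \textbf{Theorem.} There is an absolute constant $C$ such that for every properly weighted tree $T$ with $n\ge 2$ nodes, the greedy method can be carried out, and every possible outcome of it (however the ties and free choices are resolved) is a polygonal partition for $T$ with aspect ratio at most $C\,(\mathrm{depth}(T)+\log_2 n)^8$. \textbf{Good cuts lemma.} Moreover, let $P\subset\mathbb R^2$ be a convex polygon with $k$ vertices and let $a\in(0,1/2]$. Then $P$ can be cut by a straight line into two convex polygons $P_1,P_2$ with at most $k+1$ vertices each, such that $\mathrm{area}(P_1)=a\cdot\mathrm{area}(P)$, $\mathrm{area}(P_2)=(1-a)\cdot\mathrm{area}(P)$ and $$\max\{\mathrm{ar}(P_1),\mathrm{ar}(P_2)\}\le\max\left\{\mathrm{ar}(P)\left(1+\tfrac6k\right),\,k^8\right\}.$$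 -/

import Mathlib

open MeasureTheory

namespace FatPartition

/-! ### Convex polygons in the Euclidean plane -/

/-- The Euclidean plane. -/
abbrev Plane : Type := EuclideanSpace ℝ (Fin 2)

/-- A (nondegenerate) convex polygon: the convex hull of a finite set of points that has nonempty
interior. -/
def IsConvexPolygon (P : Set Plane) : Prop :=
  (∃ s : Finset Plane, P = convexHull ℝ (s : Set Plane)) ∧ (interior P).Nonempty

/-- The number of vertices of a convex polygon; its vertices are its extreme points. -/
noncomputable def numVertices (P : Set Plane) : ℕ := (P.extremePoints ℝ).ncard

/-- Area (two-dimensional Lebesgue measure). -/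
noncomputable def area (P : Set Plane) : ℝ := volume.real P

/-- The aspect ratio `diam(P)² / area(P)`. -/
noncomputable def aspectRatio (P : Set Plane) : ℝ := Metric.diam P ^ 2 / area P

/-- The unit square `[0,1]²`. -/
def unitSquare : Set Plane := {x | ∀ i, 0 ≤ x i ∧ x i ≤ 1}

/-! ### Cuts -/

/-- `P₁` and `P₂` are the two pieces, of areas `a₁` and `a₂` respectively, into which `P` is cut by
some straight line `{x | ⟪u, x⟫ = c}`. Since `u` may be replaced by `-u`, both choices of the side on
which the piece of area `a₁` lies are covered. -/
def IsCut (P : Set Plane) (a₁ a₂ : ℝ) (P₁ P₂ : Set Plane) : Prop :=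
  (∃ (u : Plane) (c : ℝ), u ≠ 0 ∧
    P₁ = P ∩ {x | inner ℝ u x ≤ c} ∧ P₂ = P ∩ {x | c ≤ inner ℝ u x}) ∧
  area P₁ = a₁ ∧ area P₂ = a₂

/-- A cut of `P` into pieces of the prescribed areas that minimizes, among all such cuts, the maximum
of the aspect ratios of the two pieces. -/
def IsGreedyCut (P : Set Plane) (a₁ a₂ : ℝ) (P₁ P₂ : Set Plane) : Prop :=
  IsCut P a₁ a₂ P₁ P₂ ∧
  ∀ Q₁ Q₂, IsCut P a₁ a₂ Q₁ Q₂ →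
    max (aspectRatio P₁) (aspectRatio P₂) ≤ max (aspectRatio Q₁) (aspectRatio Q₂)

/-! ### Weighted rooted trees and polygonal partitions

A rooted tree is ordered by `μ ≤ ν` iff `μ` is an ancestor of `ν` (or `ν` itself); its root is `⊥`. -/

section Tree

variable {T : RootedTree} [Fintype T]

open Classical in
/-- The children of a node. -/
noncomputable def children (ν : T) : Finset T := Finset.univ.filter (fun μ => ν ⋖ μ)

/-- The number of nodes in the subtree rooted at `ν`. -/
noncomputable def subtreeSize (ν : T) : ℕ := (Set.Ici ν).ncard

variable (T) in
/-- The depth of a tree: the maximum number of proper ancestors of a node, which is the number of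
edges on a longest path starting at the root. -/
noncomputable def depth : ℕ := Finset.univ.sup (fun ν : T => (Set.Iio ν).ncard)

/-- All weights are positive, the weight of each internal node is the sum of the weights of its
children, and the root has weight `1`. -/
def IsProperlyWeighted (w : T → ℝ) : Prop :=
  (∀ ν, 0 < w ν) ∧
  (∀ ν, (children ν).Nonempty → w ν = ∑ μ ∈ children ν, w μ) ∧
  w ⊥ = 1

/-- `P` assigns to each node a convex polygon, whose area is the weight of the node; the root gets the
unit square; and the polygons of the children of an internal node cover its polygon and have pairwise
disjoint interiors. -/
def IsPolygonalPartition (w : T → ℝ) (P : T → Set Plane) : Prop :=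
  (∀ ν, IsConvexPolygon (P ν)) ∧
  P ⊥ = unitSquare ∧
  (∀ ν, area (P ν) = w ν) ∧
  ∀ ν, (children ν).Nonempty →
    P ν = ⋃ μ ∈ children ν, P μ ∧
    ∀ μ₁ ∈ children ν, ∀ μ₂ ∈ children ν, μ₁ ≠ μ₂ → Disjoint (interior (P μ₁)) (interior (P μ₂))

/-! ### The transformation into a binary tree -/

/-- Trees in which every node has at most two children, and in which each node either is one of the
original nodes `v : V` (label `some v`) or is a new node (label `none`). Leaves are original. -/
inductive BinTree (V : Type*) where
  | leaf (v : V) : BinTree V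
  | unary (o : Option V) (t : BinTree V) : BinTree V
  | binary (o : Option V) (l r : BinTree V) : BinTree V

/-- The weight of (the root of) a `BinTree`: the sum of the weights of its leaves. -/
def BinTree.weight {V : Type*} (w : V → ℝ) : BinTree V → ℝ
  | .leaf v => w v
  | .unary _ t => t.weight w
  | .binary _ l r => l.weight w + r.weight w

open Classical in
/-- `Binarizes o C t`: the recursive transformation, when it reaches a node with label `o` whose
children are the original nodes in `C`, can produce the binary tree `t`.

If there are at most two children, it recurses on them. If there are at least three, let `μ` be a child
with largest subtree and split the other children into nonempty sets `C₁`, `C₂`, each having fewer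
than half of the nodes of the subtree of the current node (the current node included in the count).
The current node gets as children a new node `ν₁` with set of children `C₁` and a new node `ν₂`, whose
children are `μ` and a new node `ν₃` with set of children `C₂`; recurse on `ν₁`, `μ` and `ν₃`. -/
inductive Binarizes : Option T → Finset T → BinTree T → Prop where
  | leaf (v : T) : Binarizes (some v) ∅ (.leaf v)
  | one (o : Option T) (u : T) (t : BinTree T) :
      Binarizes (some u) (children u) t →
      Binarizes o {u} (.unary o t)
  | two (o : Option T) (u v : T) (t₁ t₂ : BinTree T) :
      u ≠ v →
      Binarizes (some u) (children u) t₁ →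
      Binarizes (some v) (children v) t₂ →
      Binarizes o {u, v} (.binary o t₁ t₂)
  | many (o : Option T) (C C₁ C₂ : Finset T) (μ : T) (t₁ t t₃ : BinTree T) :
      3 ≤ C.card →
      μ ∈ C →
      (∀ u ∈ C, subtreeSize u ≤ subtreeSize μ) →
      C₁ ∪ C₂ = C \ {μ} →
      Disjoint C₁ C₂ →
      C₁.Nonempty →
      C₂.Nonempty →
      2 * ∑ u ∈ C₁, subtreeSize u < 1 + ∑ u ∈ C, subtreeSize u →
      2 * ∑ u ∈ C₂, subtreeSize u < 1 + ∑ u ∈ C, subtreeSize u →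
      Binarizes none C₁ t₁ →
      Binarizes (some μ) (children μ) t →
      Binarizes none C₂ t₃ →
      Binarizes o C (.binary o t₁ (.binary none t t₃))

/-! ### The greedy method -/

/-- `GreedyCuts w P t R`: the polygons `P` of the original nodes in `t` arise from recursively applying
greedy cuts, starting with the polygon `R` at the root of `t`. A node with two children has its
polygon cut greedily into pieces whose areas are the weights of the children. A node with just one
child is suppressed: it and its child get the same polygon. -/
def GreedyCuts {V : Type*} (w : V → ℝ) (P : V → Set Plane) : BinTree V → Set Plane → Prop
  | .leaf v, R => P v = R
  | .unary o t, R => (∀ v, o = some v → P v = R) ∧ GreedyCuts w P t R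
  | .binary o l r, R => (∀ v, o = some v → P v = R) ∧
      ∃ R₁ R₂, IsGreedyCut R (l.weight w) (r.weight w) R₁ R₂ ∧
        GreedyCuts w P l R₁ ∧ GreedyCuts w P r R₂

/-- `P` is a possible outcome of the greedy method on the weighted tree `(T, w)`: transform `T` into a
binary tree, cut the unit square recursively by greedy cuts, and keep the polygons of the nodes
of `T`. All ties and free choices may be resolved arbitrarily. -/
def IsGreedyOutcome (w : T → ℝ) (P : T → Set Plane) : Prop :=
  ∃ t : BinTree T, Binarizes (some ⊥) (children (⊥ : T)) t ∧ GreedyCuts w P t unitSquare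

end Tree

end FatPartition

namespace FatPartition

/-! ### Basic facts about convex polygons. -/

open Set Filter Topology

/-! Everything rests on one geometric fact, `exists_good_cut`. A polygon with at most `k` vertices
has a corner `v` that is not too flat: `k + 1` directions in a fan are each minimized at some
vertex, so two of them share a vertex, and their bisector `u` satisfies `‖x - v‖ ≤ (5/2) k ⟪u, x -
v⟫` on `P` (`exists_corner`). The cut is made perpendicular to `u`, at the height `t` above `v` that
gives the prescribed areas.

If the chord at height `t` is shorter than about `t / k²`, convexity makes `P` narrow everywhere, so
each piece is nearly a segment. Scaled copies of `P` about the lowest and the highest point fit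
inside the pieces, so the lengths of the pieces are at most about `√a` and `√(1 - a)` times the
diameter; the aspect ratios then grow only by a factor `1 + 6/k`.

If the chord is longer, the triangle spanned by it and `v` gives the lower piece area at least of
order `t² / k²`, while the corner estimate bounds its diameter by `5kt`; so its aspect ratio is
polynomial in `k`. The upper piece loses little area when `a` is small. When `a` is large, `t` is a
fixed fraction of the total height and the same area estimate bounds its aspect ratio polynomially.

Since `k⁸ (1 + 6/k) ≤ (k + 1)⁸`, the invariant "at most `k` vertices and aspect ratio at most `k⁸`"
passes to both pieces of a greedy cut with `k + 1` in place of `k` (`IsGreedyCut.bound`). Starting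
with `k = 4` at the square, it remains to count cuts. Going down to an original child costs at most
two cuts, charged to the level. Going to a group of siblings costs at most two cuts and at least
halves the number of nodes, which is charged to the logarithm (`realizes_of_greedyCuts`). Greedy
cuts exist by compactness and semicontinuity (`exists_isGreedyCut`), and balanced splittings of the
children by a maximality argument (`exists_balanced_split`). -/

theorem IsConvexPolygon.convex {P : Set Plane} (h : IsConvexPolygon P) : Convex ℝ P := by
  obtain ⟨⟨s, rfl⟩, -⟩ := h
  exact convex_convexHull ℝ _

theorem IsConvexPolygon.isCompact {P : Set Plane} (h : IsConvexPolygon P) : IsCompact P := by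
  obtain ⟨⟨s, rfl⟩, -⟩ := h
  exact s.finite_toSet.isCompact_convexHull ℝ

theorem IsConvexPolygon.nonempty {P : Set Plane} (h : IsConvexPolygon P) : P.Nonempty :=
  h.2.mono interior_subset

theorem IsConvexPolygon.finite_extremePoints {P : Set Plane} (h : IsConvexPolygon P) :
    (P.extremePoints ℝ).Finite := by
  obtain ⟨⟨s, rfl⟩, -⟩ := h
  exact s.finite_toSet.subset extremePoints_convexHull_subset

theorem convexHull_extremePoints_of_finite {P : Set Plane} (hc : IsCompact P) (hP : Convex ℝ P)
    (hf : (P.extremePoints ℝ).Finite) : convexHull ℝ (P.extremePoints ℝ) = P := by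
  rw [← (hf.isClosed_convexHull ℝ).closure_eq]
  exact closure_convexHull_extremePoints hc hP

theorem IsConvexPolygon.convexHull_extremePoints {P : Set Plane} (h : IsConvexPolygon P) :
    convexHull ℝ (P.extremePoints ℝ) = P :=
  convexHull_extremePoints_of_finite h.isCompact h.convex h.finite_extremePoints

theorem interior_nonempty_of_area_pos {P : Set Plane} (hP : Convex ℝ P) (h : 0 < area P) :
    (interior P).Nonempty := by
  by_contra hne
  rw [not_nonempty_iff_eq_empty] at hne
  have h1 : volume (frontier P) = 0 := hP.addHaar_frontier volume
  have h2 : volume P = 0 := by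
    refine measure_mono_null ?_ h1
    rw [frontier, hne, sdiff_empty]
    exact subset_closure
  simp [area, Measure.real, h2] at h

theorem IsConvexPolygon.area_pos {P : Set Plane} (h : IsConvexPolygon P) : 0 < area P := by
  refine ENNReal.toReal_pos ?_ h.isCompact.measure_lt_top.ne
  exact (Measure.measure_pos_of_nonempty_interior _ h.2).ne'

theorem isConvexPolygon_of_finite {P : Set Plane} (hc : IsCompact P) (hP : Convex ℝ P)
    (hf : (P.extremePoints ℝ).Finite) (h : 0 < area P) : IsConvexPolygon P :=
  ⟨⟨hf.toFinset, by
    rw [hf.coe_toFinset, convexHull_extremePoints_of_finite hc hP hf]⟩,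
    interior_nonempty_of_area_pos hP h⟩

/-- Nonempty interior forces the vertices to span the plane affinely, and two points span at most a
line. -/
theorem IsConvexPolygon.three_le_numVertices {P : Set Plane} (h : IsConvexPolygon P) :
    3 ≤ numVertices P := by
  have h1 := h.2
  rw [← h.convexHull_extremePoints, interior_convexHull_nonempty_iff_affineSpan_eq_top] at h1
  have := h.finite_extremePoints.fintype
  by_contra hlt
  have hcard : Fintype.card (P.extremePoints ℝ) = numVertices P := by
    rw [numVertices, ← Nat.card_coe_set_eq, Nat.card_eq_fintype_card]
  have hne : Nonempty (P.extremePoints ℝ) := by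
    rw [nonempty_coe_sort, nonempty_iff_ne_empty]
    intro h0
    rw [h0, AffineSubspace.span_empty] at h1
    exact AffineSubspace.bot_ne_top ℝ Plane Plane h1
  have h2 : Module.finrank ℝ (vectorSpan ℝ (P.extremePoints ℝ)) = 2 := by
    rw [← direction_affineSpan, h1, AffineSubspace.direction_top, finrank_top]
    simp
  have hpos : 0 < Fintype.card (P.extremePoints ℝ) := Fintype.card_pos
  have h3 := finrank_vectorSpan_range_le ℝ ((↑) : P.extremePoints ℝ → Plane)
    (n := Fintype.card (P.extremePoints ℝ) - 1) (Nat.sub_add_cancel hpos).symm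
  rw [Subtype.range_coe, h2] at h3
  omega

/-! ### Halfplanes -/

theorem volume_line (u : Plane) (hu : u ≠ 0) (c : ℝ) :
    volume {x : Plane | inner ℝ u x = c} = 0 := by
  rcases eq_empty_or_nonempty {x : Plane | inner ℝ u x = c} with h | ⟨p, hp⟩
  · rw [h, measure_empty]
  have hp' : inner ℝ u p = c := hp
  have h1 := Measure.addHaar_affineSubspace (volume : Measure Plane)
    (AffineSubspace.mk' p (LinearMap.ker (innerₗ Plane u))) (by
      intro htop
      have h2 : p + u ∈ AffineSubspace.mk' p (LinearMap.ker (innerₗ Plane u)) := by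
        rw [htop]; trivial
      rw [AffineSubspace.mem_mk'] at h2
      simp at h2
      exact hu h2)
  refine measure_mono_null (fun x hx => ?_) h1
  have hx' : inner ℝ u x = c := hx
  simp [AffineSubspace.mem_mk', inner_sub_right, hp', hx']

theorem isClosed_halfplane_le (u : Plane) (c : ℝ) : IsClosed {x : Plane | inner ℝ u x ≤ c} :=
  isClosed_le (by fun_prop) continuous_const

theorem isClosed_halfplane_ge (u : Plane) (c : ℝ) : IsClosed {x : Plane | c ≤ inner ℝ u x} :=
  isClosed_le continuous_const (by fun_prop)

theorem convex_halfplane_le (u : Plane) (c : ℝ) : Convex ℝ {x : Plane | inner ℝ u x ≤ c} :=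
  convex_halfSpace_le (innerₗ Plane u).isLinear c

theorem convex_halfplane_ge (u : Plane) (c : ℝ) : Convex ℝ {x : Plane | c ≤ inner ℝ u x} :=
  convex_halfSpace_ge (innerₗ Plane u).isLinear c

theorem halfplane_ge_eq (u : Plane) (c : ℝ) :
    {x : Plane | c ≤ inner ℝ u x} = {x : Plane | inner ℝ (-u) x ≤ -c} := by
  ext x; simp

theorem area_inter_halfplane_add {P : Set Plane} (hc : IsCompact P) {u : Plane} (hu : u ≠ 0)
    (c : ℝ) :
    area (P ∩ {x | inner ℝ u x ≤ c}) + area (P ∩ {x | c ≤ inner ℝ u x}) = area P := by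
  have hfin : volume P ≠ ⊤ := hc.measure_lt_top.ne
  have hU : P ∩ {x | inner ℝ u x ≤ c} ∪ P ∩ {x | c ≤ inner ℝ u x} = P := by
    rw [← inter_union_distrib_left, inter_eq_left]
    exact fun x _ => le_total (inner ℝ u x) c
  have h1 := measureReal_union_add_inter (μ := volume) (s := P ∩ {x | inner ℝ u x ≤ c})
    (t := P ∩ {x | c ≤ inner ℝ u x}) (hc.measurableSet.inter (isClosed_halfplane_ge u c).measurableSet)
    (ne_top_of_le_ne_top hfin (measure_mono inter_subset_left))
    (ne_top_of_le_ne_top hfin (measure_mono inter_subset_left))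
  have h2 : volume.real ((P ∩ {x | inner ℝ u x ≤ c}) ∩ (P ∩ {x | c ≤ inner ℝ u x})) = 0 := by
    rw [Measure.real, measure_mono_null _ (volume_line u hu c), ENNReal.toReal_zero]
    exact fun x hx => le_antisymm hx.1.2 hx.2.2
  rw [hU, h2] at h1
  simp only [area]
  linarith

/-- An interior point on the boundary line could be moved slightly in direction `u` and would leave
the half-plane. -/
theorem interior_halfplane_le {u : Plane} (hu : u ≠ 0) {c : ℝ} {s : Set Plane}
    (hs : s ⊆ {x | inner ℝ u x ≤ c}) : interior s ⊆ {x | inner ℝ u x < c} := by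
  intro x hx
  have hx1 : inner ℝ u x ≤ c := hs (interior_subset hx)
  refine lt_of_le_of_ne hx1 fun heq => ?_
  have h1 : ∀ᶠ ε : ℝ in 𝓝 0, x + ε • u ∈ interior s := by
    have hcont : ContinuousAt (fun ε : ℝ => x + ε • u) 0 := by fun_prop
    exact hcont.eventually_mem (isOpen_interior.mem_nhds (by simpa using hx))
  have h2 : ∀ᶠ ε : ℝ in 𝓝[>] 0, x + ε • u ∈ interior s := h1.filter_mono nhdsWithin_le_nhds
  obtain ⟨ε, hε, hε0⟩ := (h2.and self_mem_nhdsWithin).exists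
  have h3 : inner ℝ u (x + ε • u) ≤ c := hs (interior_subset hε)
  rw [inner_add_right, inner_smul_right, heq] at h3
  have h4 : 0 < inner ℝ u u := real_inner_self_pos.2 hu
  have : 0 < ε * inner ℝ u u := mul_pos hε0 h4
  linarith

theorem IsCut.symm {P : Set Plane} {a₁ a₂ : ℝ} {P₁ P₂ : Set Plane} (h : IsCut P a₁ a₂ P₁ P₂) :
    IsCut P a₂ a₁ P₂ P₁ := by
  obtain ⟨⟨u, c, hu, rfl, rfl⟩, h1, h2⟩ := h
  refine ⟨⟨-u, -c, neg_ne_zero.2 hu, ?_, ?_⟩, h2, h1⟩ <;> ext x <;> simp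

theorem IsCut.union_eq {P : Set Plane} {a₁ a₂ : ℝ} {P₁ P₂ : Set Plane}
    (h : IsCut P a₁ a₂ P₁ P₂) : P = P₁ ∪ P₂ := by
  obtain ⟨⟨u, c, hu, rfl, rfl⟩, -⟩ := h
  rw [← inter_union_distrib_left, eq_comm, inter_eq_left]
  exact fun x _ => le_total (inner ℝ u x) c

theorem IsCut.disjoint_interior {P : Set Plane} {a₁ a₂ : ℝ} {P₁ P₂ : Set Plane}
    (h : IsCut P a₁ a₂ P₁ P₂) : Disjoint (interior P₁) (interior P₂) := by
  obtain ⟨⟨u, c, hu, rfl, rfl⟩, -⟩ := h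
  rw [disjoint_left]
  intro x h1 h2
  have h3 := interior_halfplane_le hu inter_subset_right h1
  rw [halfplane_ge_eq] at h2
  have h4 := interior_halfplane_le (neg_ne_zero.2 hu) inter_subset_right h2
  simp only [mem_ofPred_eq, inner_neg_left, neg_lt_neg_iff] at h3 h4
  exact lt_asymm h3 h4

/-! ### Vertices of a piece -/

/-- A compact slice along a line lies between the two points where the coordinate along the line is
least and greatest. -/
theorem extremePoints_inter_line_subset {P : Set Plane} (hc : IsCompact P)
    {u : Plane} (hu : u ≠ 0) (c : ℝ) :
    ∃ p q : Plane, (P ∩ {x | inner ℝ u x = c}).extremePoints ℝ ⊆ {p, q} := by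
  set L := P ∩ {x | inner ℝ u x = c} with hL
  rcases eq_empty_or_nonempty L with h0 | hne
  · exact ⟨0, 0, by rw [h0]; simp⟩
  have hLc : IsCompact L := hc.inter_right (isClosed_eq (by fun_prop) continuous_const)
  have hn : Continuous fun x : Plane => u 0 * x 1 - u 1 * x 0 := by fun_prop
  obtain ⟨p, hp, hpm⟩ := hLc.exists_isMinOn hne hn.continuousOn
  obtain ⟨q, hq, hqm⟩ := hLc.exists_isMaxOn hne hn.continuousOn
  refine ⟨p, q, fun x hx => ?_⟩
  rw [mem_extremePoints_iff_forall_segment] at hx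
  obtain ⟨hxL, hx⟩ := hx
  have h1 : u 0 * p 1 - u 1 * p 0 ≤ u 0 * x 1 - u 1 * x 0 := hpm hxL
  have h2 : u 0 * x 1 - u 1 * x 0 ≤ u 0 * q 1 - u 1 * q 0 := hqm hxL
  -- On the line `⟪u, x⟫ = c` a point is determined by its coordinate `u 0 * x 1 - u 1 * x 0` in the
  -- perpendicular direction.
  have key : ∀ y z : Plane, inner ℝ u y = c → inner ℝ u z = c →
      u 0 * y 1 - u 1 * y 0 = u 0 * z 1 - u 1 * z 0 → y = z := by
    intro y z hy hz hyz
    simp [PiLp.inner_apply, Fin.sum_univ_two] at hy hz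
    have hpos : 0 < u 0 ^ 2 + u 1 ^ 2 := by
      by_contra hle
      have h0 : u 0 = 0 := by nlinarith [sq_nonneg (u 0), sq_nonneg (u 1)]
      have h1 : u 1 = 0 := by nlinarith [sq_nonneg (u 0), sq_nonneg (u 1)]
      exact hu (by ext i; fin_cases i <;> simp [h0, h1])
    have e0 : (u 0 ^ 2 + u 1 ^ 2) * (y 0 - z 0) = 0 := by
      linear_combination u 0 * hy - u 0 * hz - u 1 * hyz
    have e1 : (u 0 ^ 2 + u 1 ^ 2) * (y 1 - z 1) = 0 := by
      linear_combination u 1 * hy - u 1 * hz + u 0 * hyz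
    have f0 := (mul_eq_zero.1 e0).resolve_left hpos.ne'
    have f1 := (mul_eq_zero.1 e1).resolve_left hpos.ne'
    ext i; fin_cases i <;> simp <;> linarith
  have hseg : x ∈ segment ℝ p q := by
    rcases h1.eq_or_lt with h | h
    · rw [key x p hxL.2 hp.2 h.symm]; exact left_mem_segment ℝ p q
    set α := u 0 * p 1 - u 1 * p 0 with hα
    set β := u 0 * q 1 - u 1 * q 0 with hβ
    set γ := u 0 * x 1 - u 1 * x 0 with hγ
    have hαβ : 0 < β - α := by linarith
    refine ⟨(β - γ) / (β - α), (γ - α) / (β - α), div_nonneg (by linarith) hαβ.le, div_nonneg (by linarith) hαβ.le, ?_, ?_⟩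
    · field_simp; ring
    · symm
      apply key _ _ hxL.2
      · rw [inner_add_right, inner_smul_right, inner_smul_right, hp.2, hq.2]
        field_simp; ring
      · simp only [PiLp.add_apply, PiLp.smul_apply, smul_eq_mul]
        rw [← hγ]
        have : γ = (β - γ) / (β - α) * α + (γ - α) / (β - α) * β := by field_simp; ring
        rw [hα, hβ] at this
        linear_combination this
  rcases hx p hp q hq hseg with h | h
  · left; exact h.symm
  · right; exact h.symm

/-- Extremality is local: strictly inside the half-plane, a segment of `P` through `x` can be shrunk
towards `x` until it lies in the piece. -/
theorem extremePoints_inter_halfplane_subset {P : Set Plane} (hP : Convex ℝ P) (u : Plane) (c : ℝ) :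
    (P ∩ {x | inner ℝ u x ≤ c}).extremePoints ℝ ⊆
      (P.extremePoints ℝ ∩ {x | inner ℝ u x < c}) ∪
        (P ∩ {x | inner ℝ u x = c}).extremePoints ℝ := by
  intro x hx
  have hxP := hx.1
  rcases (show inner ℝ u x ≤ c from hxP.2).lt_or_eq with hlt | heq
  · left
    refine ⟨⟨hxP.1, ?_⟩, hlt⟩
    intro y hy z hz hxyz
    have hcont : ∀ y : Plane, ∀ᶠ ε : ℝ in 𝓝[>] 0, inner ℝ u (x + ε • (y - x)) < c := by
      intro y
      have h1 : ContinuousAt (fun ε : ℝ => inner ℝ u (x + ε • (y - x))) 0 := by fun_prop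
      exact (h1.eventually_lt continuousAt_const (by simpa using hlt)).filter_mono
        nhdsWithin_le_nhds
    have hε1 : ∀ᶠ ε : ℝ in 𝓝[>] 0, ε < 1 :=
      (eventually_lt_nhds one_pos).filter_mono nhdsWithin_le_nhds
    obtain ⟨ε, ⟨⟨hεy, hεz⟩, hε1⟩, hε0⟩ :=
      (((hcont y).and (hcont z)).and hε1).and self_mem_nhdsWithin |>.exists
    have hε0 : 0 < ε := hε0
    have hmem : ∀ y ∈ P, inner ℝ u (x + ε • (y - x)) < c →
        x + ε • (y - x) ∈ P ∩ {x | inner ℝ u x ≤ c} := by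
      intro y hy h
      refine ⟨?_, h.le⟩
      exact hP.add_smul_sub_mem hxP.1 hy ⟨hε0.le, hε1.le⟩
    have := hx.2 (hmem y hy hεy) (hmem z hz hεz) (by
      obtain ⟨a, b, ha, hb, hab, h⟩ := hxyz
      refine ⟨a, b, ha, hb, hab, ?_⟩
      have : a • (x + ε • (y - x)) + b • (x + ε • (z - x))
          = (a + b) • x + ε • ((a • y + b • z) - (a + b) • x) := by module
      rw [this, h, hab]; simp)
    have h2 : ε • (y - x) = 0 := by simpa using this
    rw [smul_eq_zero, sub_eq_zero] at h2
    exact h2.resolve_left hε0.ne'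
  · right
    refine ⟨⟨hxP.1, heq⟩, ?_⟩
    intro y hy z hz hxyz
    exact hx.2 ⟨hy.1, le_of_eq hy.2⟩ ⟨hz.1, le_of_eq hz.2⟩ hxyz

/-- The cut creates at most two new vertices, on the line. At least one old vertex is lost, because
the other piece has positive area and so some vertex lies strictly beyond the line. -/
theorem IsCut.left_isConvexPolygon {P : Set Plane} (h : IsConvexPolygon P) {a₁ a₂ : ℝ}
    {P₁ P₂ : Set Plane} (hcut : IsCut P a₁ a₂ P₁ P₂) (h₁ : 0 < a₁) (h₂ : 0 < a₂) :
    IsConvexPolygon P₁ ∧ numVertices P₁ ≤ numVertices P + 1 := by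
  obtain ⟨⟨u, c, hu, rfl, rfl⟩, e1, e2⟩ := hcut
  obtain ⟨p, q, hpq⟩ := extremePoints_inter_line_subset h.isCompact hu c
  have hsub := (extremePoints_inter_halfplane_subset h.convex u c).trans
    (union_subset_union_right _ hpq)
  have hVfin := h.finite_extremePoints
  have hfin : ((P.extremePoints ℝ ∩ {x | inner ℝ u x < c}) ∪ {p, q}).Finite :=
    (hVfin.inter_of_left _).union (by simp)
  refine ⟨isConvexPolygon_of_finite (h.isCompact.inter_right (isClosed_halfplane_le u c))
    (h.convex.inter (convex_halfplane_le u c)) (hfin.subset hsub) (by rw [e1]; exact h₁), ?_⟩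
  have hv : ∃ v ∈ P.extremePoints ℝ, c < inner ℝ u v := by
    by_contra! hle
    have hPle : P ⊆ {x | inner ℝ u x ≤ c} := by
      rw [← h.convexHull_extremePoints]
      exact convexHull_min hle (convex_halfplane_le u c)
    have : area (P ∩ {x | c ≤ inner ℝ u x}) = 0 := by
      rw [area, Measure.real, measure_mono_null _ (volume_line u hu c), ENNReal.toReal_zero]
      exact fun x hx => le_antisymm (hPle hx.1) hx.2
    linarith
  obtain ⟨v, hv, hvc⟩ := hv
  have hlt : (P.extremePoints ℝ ∩ {x | inner ℝ u x < c}).ncard < numVertices P := by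
    refine ncard_lt_ncard ⟨inter_subset_left, fun hss => ?_⟩ hVfin
    exact lt_asymm hvc (hss hv).2
  have h3 := (ncard_le_ncard hsub hfin).trans (ncard_union_le _ _)
  have h4 : ({p, q} : Set Plane).ncard ≤ 2 := (ncard_insert_le p {q}).trans (by rw [ncard_singleton])
  rw [numVertices]
  omega

theorem IsCut.isConvexPolygon {P : Set Plane} (h : IsConvexPolygon P) {a₁ a₂ : ℝ}
    {P₁ P₂ : Set Plane} (hcut : IsCut P a₁ a₂ P₁ P₂) (h₁ : 0 < a₁) (h₂ : 0 < a₂) :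
    (IsConvexPolygon P₁ ∧ numVertices P₁ ≤ numVertices P + 1) ∧
      IsConvexPolygon P₂ ∧ numVertices P₂ ≤ numVertices P + 1 :=
  ⟨hcut.left_isConvexPolygon h h₁ h₂, hcut.symm.left_isConvexPolygon h h₂ h₁⟩

/-! ### Existence of cuts and of greedy cuts -/

/-- Dominated convergence: membership in the half-plane is locally constant in its parameters except
at points of the boundary line, which is a null set. -/
theorem continuousAt_area_halfplane {P : Set Plane} (hc : IsCompact P) (y : Plane × ℝ)
    (hy : y.1 ≠ 0) :
    ContinuousAt (fun y : Plane × ℝ => area (P ∩ {x | inner ℝ y.1 x ≤ y.2})) y := by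
  refine (ENNReal.continuousAt_toReal ?_).tendsto.comp ?_
  · exact ne_top_of_le_ne_top hc.measure_lt_top.ne (measure_mono inter_subset_left)
  refine tendsto_measure_of_ae_tendsto_indicator (B := P) (𝓝 y)
    (hc.measurableSet.inter (isClosed_halfplane_le _ _).measurableSet)
    (fun z => hc.measurableSet.inter (isClosed_halfplane_le _ _).measurableSet)
    hc.measurableSet hc.measure_lt_top.ne (Eventually.of_forall fun _ => inter_subset_left) ?_
  have hae : ∀ᵐ x : Plane, x ∉ {x : Plane | inner ℝ y.1 x = y.2} :=
    measure_eq_zero_iff_ae_notMem.1 (volume_line y.1 hy y.2)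
  filter_upwards [hae] with x hx
  have hcont : ContinuousAt (fun z : Plane × ℝ => inner ℝ z.1 x - z.2) y := by fun_prop
  rcases lt_or_gt_of_ne (show inner ℝ y.1 x ≠ y.2 from hx) with h | h
  · filter_upwards [hcont.eventually_lt continuousAt_const (sub_neg.2 h)] with z hz
    simp [(sub_neg.1 hz).le, h.le]
  · filter_upwards [continuousAt_const.eventually_lt hcont (sub_pos.2 h)] with z hz
    simp [(sub_pos.1 hz).not_ge, h.not_ge]

theorem exists_cut_direction {P : Set Plane} (hc : IsCompact P) {a : ℝ} (ha : 0 < a)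
    (haP : a < area P) {u : Plane} (hu : u ≠ 0) :
    ∃ c, area (P ∩ {x | inner ℝ u x ≤ c}) = a := by
  obtain ⟨B, hB⟩ := hc.isBounded.exists_norm_le
  have hbd : ∀ x ∈ P, |inner ℝ u x| ≤ ‖u‖ * B := fun x hx =>
    (abs_real_inner_le_norm u x).trans (by gcongr; exact hB x hx)
  have hcont : Continuous fun c : ℝ => area (P ∩ {x | inner ℝ u x ≤ c}) := by
    refine continuous_iff_continuousAt.2 fun c => ?_
    have h1 : ContinuousAt (fun c : ℝ => ((u, c) : Plane × ℝ)) c := by fun_prop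
    have h2 := continuousAt_area_halfplane hc (u, c) hu
    exact ContinuousAt.comp (f := fun c : ℝ => ((u, c) : Plane × ℝ))
      (g := fun y : Plane × ℝ => area (P ∩ {x | inner ℝ y.1 x ≤ y.2})) h2 h1
  have hlow : area (P ∩ {x | inner ℝ u x ≤ -(‖u‖ * B)}) = 0 := by
    rw [area, Measure.real, measure_mono_null _ (volume_line u hu (-(‖u‖ * B))),
      ENNReal.toReal_zero]
    exact fun x hx => le_antisymm hx.2 (neg_le_of_abs_le (hbd x hx.1))
  have hhigh : area (P ∩ {x | inner ℝ u x ≤ ‖u‖ * B}) = area P := by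
    have h : P ⊆ {x | inner ℝ u x ≤ ‖u‖ * B} := fun x hx => le_of_abs_le (hbd x hx)
    rw [inter_eq_left.2 h]
  obtain ⟨c, hc⟩ := mem_range_of_exists_le_of_exists_ge (c := a) hcont
    ⟨-(‖u‖ * B), by rw [hlow]; exact ha.le⟩ ⟨‖u‖ * B, by rw [hhigh]; exact haP.le⟩
  exact ⟨c, hc⟩

theorem isCut_halfplanes {P : Set Plane} (hc : IsCompact P) {a₁ a₂ : ℝ} (ha : a₁ + a₂ = area P)
    {u : Plane} (hu : u ≠ 0) {c : ℝ} (h : area (P ∩ {x | inner ℝ u x ≤ c}) = a₁) :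
    IsCut P a₁ a₂ (P ∩ {x | inner ℝ u x ≤ c}) (P ∩ {x | c ≤ inner ℝ u x}) := by
  refine ⟨⟨u, c, hu, rfl, rfl⟩, h, ?_⟩
  have := area_inter_halfplane_add hc hu c
  linarith

theorem exists_dist_gt_interior {Q : Set Plane} (hQ : Convex ℝ Q) (hne : (interior Q).Nonempty)
    {r : ℝ} (hr : 0 ≤ r) (h : r < Metric.diam Q) :
    ∃ p ∈ interior Q, ∃ q ∈ interior Q, r < dist p q := by
  by_contra! hle
  have h1 : ∀ p ∈ closure (interior Q), ∀ q ∈ closure (interior Q), dist p q ≤ r := by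
    intro p hp q hq
    have := map_mem_closure₂ (f := fun p q : Plane => dist p q) continuous_dist hp hq
      (u := Iic r) (fun p hp q hq => hle p hp q hq)
    rwa [isClosed_Iic.closure_eq] at this
  rw [hQ.closure_interior_eq_closure_of_nonempty_interior hne] at h1
  refine absurd (Metric.diam_le_of_forall_dist_le hr fun p hp q hq =>
    h1 p (subset_closure hp) q (subset_closure hq)) (not_le.2 h)

/-- A diameter greater than `r` is witnessed by two points in the interior of the piece, and these
stay in the piece after a small change of the line. Positive area supplies the interior. -/
theorem lowerSemicontinuousOn_diam_halfplane {P : Set Plane} (hc : IsCompact P) (hP : Convex ℝ P) :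
    LowerSemicontinuousOn (fun y : Plane × ℝ => Metric.diam (P ∩ {x | inner ℝ y.1 x ≤ y.2}))
      {y | y.1 ≠ 0 ∧ 0 < area (P ∩ {x | inner ℝ y.1 x ≤ y.2})} := by
  rintro y ⟨hy, hya⟩ r hr
  refine Eventually.filter_mono nhdsWithin_le_nhds ?_
  rcases lt_or_ge r 0 with hr0 | hr0
  · exact Eventually.of_forall fun z => hr0.trans_le Metric.diam_nonneg
  have hconv := hP.inter (convex_halfplane_le y.1 y.2)
  obtain ⟨p, hp, q, hq, hpq⟩ := exists_dist_gt_interior hconv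
    (interior_nonempty_of_area_pos hconv hya) hr0 hr
  have hmem : ∀ p ∈ interior (P ∩ {x | inner ℝ y.1 x ≤ y.2}),
      ∀ᶠ z : Plane × ℝ in 𝓝 y, p ∈ P ∩ {x | inner ℝ z.1 x ≤ z.2} := by
    intro p hp
    have h1 : inner ℝ y.1 p < y.2 := interior_halfplane_le hy inter_subset_right hp
    have h2 : ContinuousAt (fun z : Plane × ℝ => inner ℝ z.1 p) y := by fun_prop
    filter_upwards [h2.eventually_lt continuousAt_snd h1] with z hz
    exact ⟨(interior_subset hp).1, hz.le⟩
  filter_upwards [hmem p hp, hmem q hq] with z h1 h2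
  exact hpq.trans_le (Metric.dist_le_diam_of_mem (hc.isBounded.subset inter_subset_left) h1 h2)

/-- With unit normals the admissible lines form a compact set `K`. The areas are fixed on it, so
only the diameters vary in the objective; it is lower semicontinuous and attains its minimum. -/
theorem exists_isGreedyCut {P : Set Plane} (hc : IsCompact P) (hP : Convex ℝ P) {a₁ a₂ : ℝ}
    (h₁ : 0 < a₁) (h₂ : 0 < a₂) (ha : a₁ + a₂ = area P) :
    ∃ P₁ P₂, IsGreedyCut P a₁ a₂ P₁ P₂ := by
  obtain ⟨B, hB⟩ := hc.isBounded.exists_norm_le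
  set F : Plane × ℝ → ℝ := fun y => area (P ∩ {x | inner ℝ y.1 x ≤ y.2}) with hF
  set K : Set (Plane × ℝ) := (Metric.sphere 0 1 ×ˢ Icc (-B) B) ∩ F ⁻¹' {a₁} with hK
  have hsph : ∀ y ∈ (Metric.sphere (0 : Plane) 1 ×ˢ Icc (-B) B), y.1 ≠ 0 := by
    rintro y ⟨hy, -⟩ h0
    simp [h0] at hy
  have hKc : IsCompact K := by
    have h1 : IsCompact (Metric.sphere (0 : Plane) 1 ×ˢ Icc (-B) B) :=
      (isCompact_sphere 0 1).prod isCompact_Icc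
    exact h1.of_isClosed_subset (ContinuousOn.preimage_isClosed_of_isClosed
      (fun y hy => (continuousAt_area_halfplane hc y (hsph y hy)).continuousWithinAt)
      h1.isClosed isClosed_singleton) inter_subset_left
  have hcutK : ∀ y ∈ K, IsCut P a₁ a₂ (P ∩ {x | inner ℝ y.1 x ≤ y.2})
      (P ∩ {x | y.2 ≤ inner ℝ y.1 x}) := fun y hy => isCut_halfplanes hc ha (hsph y hy.1) hy.2
  have hnorm : ∀ Q₁ Q₂, IsCut P a₁ a₂ Q₁ Q₂ → ∃ y ∈ K, Q₁ = P ∩ {x | inner ℝ y.1 x ≤ y.2} ∧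
      Q₂ = P ∩ {x | y.2 ≤ inner ℝ y.1 x} := by
    rintro Q₁ Q₂ ⟨⟨u, c, hu, rfl, rfl⟩, e1, e2⟩
    have hu0 : 0 < ‖u‖ := norm_pos_iff.2 hu
    have hle : ∀ x, inner ℝ (‖u‖⁻¹ • u) x ≤ ‖u‖⁻¹ * c ↔ inner ℝ u x ≤ c := by
      intro x
      rw [real_inner_smul_left]
      exact mul_le_mul_iff_right₀ (inv_pos.2 hu0)
    have hge : ∀ x, ‖u‖⁻¹ * c ≤ inner ℝ (‖u‖⁻¹ • u) x ↔ c ≤ inner ℝ u x := by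
      intro x
      rw [real_inner_smul_left]
      exact mul_le_mul_iff_right₀ (inv_pos.2 hu0)
    have hu1 : ‖(‖u‖⁻¹ • u)‖ = 1 := norm_smul_inv_norm hu
    refine ⟨(‖u‖⁻¹ • u, ‖u‖⁻¹ * c), ⟨⟨by simpa using hu1, ?_⟩, ?_⟩, ?_, ?_⟩
    -- Both pieces have positive area, hence points, and these confine the offset of the line to
    -- `[-B, B]`.
    · have hne1 : (P ∩ {x | inner ℝ u x ≤ c}).Nonempty := by
        rw [nonempty_iff_ne_empty]; intro h0; rw [h0] at e1; simp [area] at e1; linarith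
      have hne2 : (P ∩ {x | c ≤ inner ℝ u x}).Nonempty := by
        rw [nonempty_iff_ne_empty]; intro h0; rw [h0] at e2; simp [area] at e2; linarith
      obtain ⟨x, hx, hxc⟩ := hne1
      obtain ⟨z, hz, hzc⟩ := hne2
      have b : ∀ x ∈ P, |inner ℝ (‖u‖⁻¹ • u) x| ≤ B := fun x hx =>
        (abs_real_inner_le_norm _ x).trans (by rw [hu1, one_mul]; exact hB x hx)
      exact ⟨(neg_le_of_abs_le (b x hx)).trans ((hle x).2 hxc),
        ((hge z).2 hzc).trans (le_of_abs_le (b z hz))⟩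
    · simp only [hF, mem_preimage, mem_singleton_iff, hle]; exact e1
    · simp only [hle]
    · simp only [hge]
  have hKne : K.Nonempty := by
    have hu : (EuclideanSpace.single 0 1 : Plane) ≠ 0 := by simp
    obtain ⟨c, hcc⟩ := exists_cut_direction hc h₁ (by linarith) hu
    obtain ⟨y, hy, -⟩ := hnorm _ _ (isCut_halfplanes hc ha hu hcc)
    exact ⟨y, hy⟩
  have hl1 : LowerSemicontinuousOn (fun y : Plane × ℝ =>
      Metric.diam (P ∩ {x | inner ℝ y.1 x ≤ y.2})) K :=
    (lowerSemicontinuousOn_diam_halfplane hc hP).mono fun y hy =>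
      ⟨hsph y hy.1, by rw [(hcutK y hy).2.1]; exact h₁⟩
  have hl2 : LowerSemicontinuousOn (fun y : Plane × ℝ =>
      Metric.diam (P ∩ {x | y.2 ≤ inner ℝ y.1 x})) K := by
    -- Negating normal and offset exchanges the two sides.
    have := (lowerSemicontinuousOn_diam_halfplane hc hP).comp (t := K) (g := fun y : Plane × ℝ => -y)
      continuous_neg.continuousOn (fun y hy => ⟨neg_ne_zero.2 (hsph y hy.1), by
        have := (hcutK y hy).2.2
        rw [halfplane_ge_eq] at this
        simp only [Prod.fst_neg, Prod.snd_neg]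
        rw [this]; exact h₂⟩)
    simpa only [Function.comp_def, Prod.fst_neg, Prod.snd_neg, ← halfplane_ge_eq] using this
  have hasp : ∀ {g : Plane × ℝ → Set Plane} {a : ℝ}, 0 < a →
      LowerSemicontinuousOn (fun y => Metric.diam (g y)) K →
      LowerSemicontinuousOn (fun y => Metric.diam (g y) ^ 2 / a) K := by
    intro g a ha hg y hy r hr
    rcases lt_or_ge r 0 with hr0 | hr0
    · exact Eventually.of_forall fun z => hr0.trans_le (by positivity)
    have h1 : √(r * a) < Metric.diam (g y) := by
      rw [Real.sqrt_lt' , ← lt_div_iff₀ ha]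
      · exact hr
      · refine Metric.diam_nonneg.lt_of_ne fun h0 => ?_
        simp [← h0] at hr
        linarith
    filter_upwards [hg y hy _ h1] with z hz
    rw [gt_iff_lt, lt_div_iff₀ ha]
    exact (Real.sqrt_lt' ((Real.sqrt_nonneg _).trans_lt hz)).1 hz
  obtain ⟨y, hyK, hmin⟩ := LowerSemicontinuousOn.exists_isMinOn hKne hKc
    ((hasp h₁ hl1).sup (hasp h₂ hl2))
  refine ⟨_, _, hcutK y hyK, fun Q₁ Q₂ hQ => ?_⟩
  obtain ⟨z, hz, rfl, rfl⟩ := hnorm Q₁ Q₂ hQ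
  have h := hmin hz
  simp only [mem_ofPred_eq] at h
  simp only [aspectRatio, (hcutK y hyK).2.1, (hcutK y hyK).2.2, (hcutK z hz).2.1, (hcutK z hz).2.2]
  exact h

/-! ### Area computations -/

theorem area_mono {P Q : Set Plane} (hQ : IsCompact Q) (h : P ⊆ Q) : area P ≤ area Q :=
  measureReal_mono h hQ.measure_lt_top.ne

theorem area_homothety (x : Plane) (r : ℝ) (s : Set Plane) :
    area (AffineMap.homothety x r '' s) = r ^ 2 * area s := by
  rw [area, Measure.real, Measure.addHaar_image_homothety, ENNReal.toReal_mul,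
    ENNReal.toReal_ofReal (abs_nonneg _)]
  simp [area, Measure.real]

theorem area_unitSquare : area unitSquare = 1 := by
  have h1 : unitSquare = (WithLp.ofLp : Plane → Fin 2 → ℝ) ⁻¹' (Icc 0 1) := by
    ext x
    simp only [unitSquare, mem_ofPred_eq, mem_preimage, mem_Icc, Pi.le_def, Pi.zero_apply,
      Pi.one_apply, forall_and]
  rw [area, Measure.real, h1,
    (PiLp.volume_preserving_ofLp (Fin 2)).measure_preimage measurableSet_Icc.nullMeasurableSet,
    Real.volume_Icc_pi]
  simp

/-- The triangle with vertices `(0,0)`, `(1,0)`, `(0,1)`. -/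
def standardTriangle : Set Plane := {x | 0 ≤ x 0 ∧ 0 ≤ x 1 ∧ x 0 + x 1 ≤ 1}

/-- The triangle and its reflection in the centre of the square cover the square. Only this lower
bound is needed. -/
theorem half_le_area_standardTriangle : 1 / 2 ≤ area standardTriangle := by
  set m : Plane := !₂[1 / 2, 1 / 2]
  have hsub : unitSquare ⊆ standardTriangle ∪ AffineMap.homothety m (-1 : ℝ) '' standardTriangle := by
    intro x hx
    have h0 := hx 0
    have h1 := hx 1
    rcases le_total (x 0 + x 1) 1 with h | h
    · exact Or.inl ⟨h0.1, h1.1, h⟩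
    · refine Or.inr ⟨!₂[1 - x 0, 1 - x 1], ⟨?_, ?_, ?_⟩, ?_⟩
      · simpa using h0.2
      · simpa using h1.2
      · simp; linarith
      · ext i; fin_cases i <;> simp [AffineMap.homothety_apply, m] <;> ring
  have hfin : volume standardTriangle ≠ ⊤ := by
    have h1 : standardTriangle ⊆ Metric.closedBall 0 2 := by
      rintro x ⟨h0, h1, h2⟩
      rw [mem_closedBall_zero_iff, EuclideanSpace.norm_eq, Real.sqrt_le_left (by norm_num)]
      simp only [Fin.sum_univ_two, Real.norm_eq_abs, sq_abs]
      nlinarith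
    exact ne_top_of_le_ne_top measure_closedBall_lt_top.ne (measure_mono h1)
  have h2 : volume (AffineMap.homothety m (-1 : ℝ) '' standardTriangle) ≠ ⊤ := by
    rw [Measure.addHaar_image_homothety]
    exact ENNReal.mul_ne_top ENNReal.ofReal_ne_top hfin
  have h3 := (measureReal_mono hsub (measure_union_lt_top hfin.lt_top h2.lt_top).ne).trans
    (measureReal_union_le _ _)
  have h4 := area_homothety m (-1) standardTriangle
  have h5 := area_unitSquare
  simp only [area] at *
  linarith

/-- By convexity `Q` contains the triangle `v p q`, an affine image of the standard triangle whose
linear part has columns `p - v` and `q - v`. -/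
theorem cross_le_area {Q : Set Plane} (hc : IsCompact Q) (hQ : Convex ℝ Q) {v p q : Plane}
    (hv : v ∈ Q) (hp : p ∈ Q) (hq : q ∈ Q) :
    |(p - v) 0 * (q - v) 1 - (q - v) 0 * (p - v) 1| / 2 ≤ area Q := by
  set A : Matrix (Fin 2) (Fin 2) ℝ := !![(p - v) 0, (q - v) 0; (p - v) 1, (q - v) 1]
  set M : Plane →ₗ[ℝ] Plane := Matrix.toLpLin 2 2 A with hM
  have hdet : LinearMap.det M = (p - v) 0 * (q - v) 1 - (q - v) 0 * (p - v) 1 := by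
    rw [hM, Matrix.toLpLin_eq_toLin, LinearMap.det_toLin, Matrix.det_fin_two_of]
  have hMx : ∀ x, M x = x 0 • (p - v) + x 1 • (q - v) := by
    intro x
    ext i
    fin_cases i <;> simp [hM, A, Matrix.toLpLin_apply, dotProduct,
      Fin.sum_univ_two] <;> ring
  have hsub : (fun x => v + x) '' (M '' standardTriangle) ⊆ Q := by
    rintro _ ⟨_, ⟨x, ⟨h0, h1, h2⟩, rfl⟩, rfl⟩
    have h3 := hQ.sum_mem (t := Finset.univ) (w := ![1 - x 0 - x 1, x 0, x 1]) (z := ![v, p, q])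
      (by intro i _; fin_cases i <;> simp <;> linarith) (by simp [Fin.sum_univ_three]; ring)
      (by intro i _; fin_cases i <;> simp [hv, hp, hq])
    have h4 : v + M x = ∑ i, ![1 - x 0 - x 1, x 0, x 1] i • ![v, p, q] i := by
      rw [hMx]; simp [Fin.sum_univ_three]; module
    change v + M x ∈ Q
    rw [h4]; exact h3
  have h1 := measureReal_mono (μ := volume) hsub hc.measure_lt_top.ne
  rw [Measure.real, image_add_left, measure_preimage_add, Measure.addHaar_image_linearMap, hdet,
    ENNReal.toReal_mul, ENNReal.toReal_ofReal (abs_nonneg _)] at h1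
  have h2 := half_le_area_standardTriangle
  have h3 := mul_le_mul_of_nonneg_left h2 (abs_nonneg ((p - v) 0 * (q - v) 1 - (q - v) 0 * (p - v) 1))
  simp only [area, Measure.real] at *
  linarith

/-- The triangle with apex `v` and base `p q` has height `t`. In the proof, `s` is the signed length
of `q - p` perpendicular to `u`. -/
theorem chord_mul_height_le_area {Q : Set Plane} (hc : IsCompact Q) (hQ : Convex ℝ Q)
    {u v p q : Plane} (hu : ‖u‖ = 1) {t : ℝ} (ht : 0 ≤ t)
    (hv : v ∈ Q) (hp : p ∈ Q) (hq : q ∈ Q) (hpt : inner ℝ u (p - v) = t)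
    (hqt : inner ℝ u (q - v) = t) : t * dist p q / 2 ≤ area Q := by
  refine le_trans (le_of_eq ?_) (cross_le_area hc hQ hv hp hq)
  congr 1
  have hu2 : u 0 ^ 2 + u 1 ^ 2 = 1 := by
    have := EuclideanSpace.norm_sq_eq u
    simpa [hu, Fin.sum_univ_two] using this.symm
  simp only [PiLp.inner_apply, Fin.sum_univ_two, PiLp.sub_apply, RCLike.inner_apply, conj_trivial]
    at hpt hqt ⊢
  rw [EuclideanSpace.dist_eq, ← Real.sqrt_sq ht, ← Real.sqrt_mul (sq_nonneg t), ← Real.sqrt_sq_eq_abs]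
  congr 1
  simp only [Fin.sum_univ_two, Real.dist_eq, sq_abs]
  have e0 : q 0 - p 0 = -(u 0 * (q 1 - p 1) - u 1 * (q 0 - p 0)) * u 1 := by
    linear_combination (-(q 0 - p 0)) * hu2 + u 0 * (hqt - hpt)
  have e1 : q 1 - p 1 = (u 0 * (q 1 - p 1) - u 1 * (q 0 - p 0)) * u 0 := by
    linear_combination (-(q 1 - p 1)) * hu2 + u 1 * (hqt - hpt)
  set s := u 0 * (q 1 - p 1) - u 1 * (q 0 - p 0)
  have hd : (p 0 - q 0) ^ 2 + (p 1 - q 1) ^ 2 = s ^ 2 := by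
    have : (p 0 - q 0) ^ 2 + (p 1 - q 1) ^ 2 = (q 0 - p 0) ^ 2 + (q 1 - p 1) ^ 2 := by ring
    rw [this, e0, e1]; linear_combination s ^ 2 * hu2
  have hcr : (p 0 - v 0) * (q 1 - v 1) - (q 0 - v 0) * (p 1 - v 1) = s * t := by
    linear_combination (p 0 - v 0) * e1 - (p 1 - v 1) * e0 + s * hpt
  rw [hd, hcr]; ring

/-! ### A corner which is not too flat -/

theorem exists_vertex_isMinOn {P : Set Plane} (h : IsConvexPolygon P) (w : Plane) :
    ∃ v ∈ P.extremePoints ℝ, ∀ x ∈ P, 0 ≤ inner ℝ w (x - v) := by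
  have hne : (P.extremePoints ℝ).Nonempty := by
    rw [nonempty_iff_ne_empty]
    intro h0
    have := h.three_le_numVertices
    rw [numVertices, h0, ncard_empty] at this
    omega
  obtain ⟨v, hv, hmin⟩ := exists_min_image _ (fun x : Plane => inner ℝ w x) h.finite_extremePoints hne
  refine ⟨v, hv, fun x hx => ?_⟩
  have hle : P ⊆ {x | inner ℝ w v ≤ inner ℝ w x} := by
    conv_lhs => rw [← h.convexHull_extremePoints]
    exact convexHull_min hmin (convex_halfplane_ge w _)
  rw [inner_sub_right]
  exact sub_nonneg.2 (hle hx)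

/-- Pigeonhole on the `k + 1` directions `(k, 2j - k)`: two of them are minimized at the same
vertex, whose normal cone is therefore not too thin. Their sum gives `u`. -/
theorem exists_corner {P : Set Plane} (h : IsConvexPolygon P) {k : ℕ} (hk3 : 3 ≤ k)
    (hk : numVertices P ≤ k) :
    ∃ v ∈ P, ∃ u : Plane, ‖u‖ = 1 ∧
      ∀ x ∈ P, 0 ≤ inner ℝ u (x - v) ∧ ‖x - v‖ ≤ 5 / 2 * k * inner ℝ u (x - v) := by
  set w : ℕ → Plane := fun j => !₂[(k : ℝ), 2 * (j : ℝ) - k] with hw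
  choose f hf hfmin using fun j : ℕ => exists_vertex_isMinOn h (w j)
  obtain ⟨i, hi, j, hj, hij, hfij⟩ := Finset.exists_ne_map_eq_of_card_lt_of_maps_to
    (s := Finset.range (k + 1)) (t := h.finite_extremePoints.toFinset) (f := f)
    (by rw [← ncard_eq_toFinset_card _ h.finite_extremePoints, Finset.card_range]; exact Nat.lt_succ_of_le hk)
    (fun i _ => by simpa using hf i)
  wlog hlt : i < j generalizing i j
  · exact this j hj i hi hij.symm hfij.symm (lt_of_le_of_ne (not_lt.1 hlt) hij.symm)
  have hkR : (3 : ℝ) ≤ k := by exact_mod_cast hk3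
  have hjk : (j : ℝ) ≤ k := by
    rw [Finset.mem_range] at hj; exact_mod_cast Nat.lt_succ_iff.1 hj
  have hij1 : (i : ℝ) + 1 ≤ j := by exact_mod_cast hlt
  have hi0 : (0 : ℝ) ≤ i := Nat.cast_nonneg i
  set W : Plane := w i + w j with hWdef
  have hW2 : ‖W‖ ^ 2 ≤ 8 * (k : ℝ) ^ 2 := by
    rw [EuclideanSpace.norm_sq_eq]
    simp only [Fin.sum_univ_two, hWdef, hw, Real.norm_eq_abs, sq_abs, PiLp.add_apply]
    simp
    nlinarith
  have hW0 : 0 < ‖W‖ := by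
    rw [norm_pos_iff]
    intro h0
    have := congrArg (fun x : Plane => x 0) h0
    simp [hWdef, hw] at this
    omega
  refine ⟨f i, (hf i).1, ‖W‖⁻¹ • W, norm_smul_inv_norm (norm_pos_iff.1 hW0), fun x hx => ?_⟩
  have e1 := hfmin i x hx
  have e2 := hfmin j x hx
  rw [← hfij] at e2
  rw [real_inner_smul_left]
  set S := inner ℝ W (x - f i) with hS
  have hS0 : S = inner ℝ (w i) (x - f i) + inner ℝ (w j) (x - f i) := by rw [hS, inner_add_left]
  have hSnn : 0 ≤ S := by rw [hS0]; linarith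
  refine ⟨by positivity, ?_⟩
  set X := (x - f i) 0 with hX
  set Y := (x - f i) 1 with hY
  have i1 : inner ℝ (w i) (x - f i) = k * X + (2 * i - k) * Y := by
    simp only [PiLp.inner_apply, Fin.sum_univ_two, hw, RCLike.inner_apply, conj_trivial, hX, hY]
    simp; ring
  have i2 : inner ℝ (w j) (x - f i) = k * X + (2 * j - k) * Y := by
    simp only [PiLp.inner_apply, Fin.sum_univ_two, hw, RCLike.inner_apply, conj_trivial, hX, hY]
    simp; ring
  rw [i1, i2] at hS0
  rw [i1] at e1
  rw [i2] at e2
  -- `S` is the sum of two nonnegative numbers, so it bounds the absolute value of their difference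
  -- `2 (j - i) Y`.
  have hY1 : 2 * |Y| ≤ S := by
    have hji : 1 ≤ (j : ℝ) - i := by linarith
    have h1 : |Y| ≤ (j - i) * |Y| := le_mul_of_one_le_left (abs_nonneg _) hji
    have h2 : 2 * ((j - i) * |Y|) ≤ S := by
      rcases abs_cases Y with ⟨h, _⟩ | ⟨h, _⟩ <;> rw [h] <;> nlinarith
    linarith
  have hX1 : |X| ≤ 2 / 3 * S := by
    have h1 : |(2 * (i : ℝ) - k) + (2 * j - k)| ≤ 2 * k := by
      rw [abs_le]; constructor <;> linarith
    have h2 : 2 * k * X = S - ((2 * (i : ℝ) - k) + (2 * j - k)) * Y := by rw [hS0]; ring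
    have h3 : 2 * k * |X| ≤ S + 2 * k * |Y| := by
      have : |2 * k * X| = 2 * k * |X| := by rw [abs_mul, abs_of_nonneg (by positivity)]
      rw [← this, h2]
      refine (abs_sub _ _).trans ?_
      rw [abs_of_nonneg hSnn, abs_mul]
      gcongr
    have h4 : 2 * k * |Y| ≤ k * S := by nlinarith
    have h5 : 2 * k * |X| ≤ 2 * k * (2 / 3 * S) := by nlinarith
    exact le_of_mul_le_mul_left h5 (by positivity)
  have hn : ‖x - f i‖ ^ 2 ≤ (5 / 6 * S) ^ 2 := by
    rw [EuclideanSpace.norm_sq_eq]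
    simp only [Fin.sum_univ_two, Real.norm_eq_abs]
    rw [← hX, ← hY]
    nlinarith [abs_nonneg X, abs_nonneg Y]
  have hn' : ‖x - f i‖ ≤ 5 / 6 * S := (sq_le_sq₀ (norm_nonneg _) (by positivity)).1 hn
  have hW3 : ‖W‖ ≤ 3 * k := (sq_le_sq₀ (norm_nonneg _) (by positivity)).1 (by nlinarith)
  calc ‖x - f i‖ ≤ 5 / 6 * S := hn'
    _ = 5 / 6 * ‖W‖ * (‖W‖⁻¹ * S) := by field_simp
    _ ≤ 5 / 6 * (3 * k) * (‖W‖⁻¹ * S) := by gcongr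
    _ = _ := by ring

/-! ### Good cuts -/

/-- A set that is close to a segment of a body is not much longer than that segment. -/
theorem diam_le_of_near_segment {P Q : Set Plane} (hP : Bornology.IsBounded P)
    {v z : Plane} (hv : v ∈ P) (hz : z ∈ P) {f : Plane → ℝ} {r W Y α : ℝ} (hY : 0 < Y) (hr : 0 ≤ r)
    (hW : 0 ≤ W) (hd : ∀ x ∈ Q, dist x (v + (f x / Y) • (z - v)) ≤ W)
    (hf : ∀ x ∈ Q, α ≤ f x ∧ f x ≤ α + r * Y) :
    Metric.diam Q ≤ r * Metric.diam P + 2 * W := by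
  refine Metric.diam_le_of_forall_dist_le (by positivity) fun x hx y hy => ?_
  have hD : ‖z - v‖ ≤ Metric.diam P := by
    rw [← dist_eq_norm]; exact Metric.dist_le_diam_of_mem hP hz hv
  have hm : dist (v + (f x / Y) • (z - v)) (v + (f y / Y) • (z - v)) ≤ r * Metric.diam P := by
    rw [dist_add_left, dist_eq_norm, ← sub_smul, norm_smul, Real.norm_eq_abs]
    refine mul_le_mul ?_ hD (norm_nonneg _) hr
    rw [← sub_div, abs_div, abs_of_pos hY, div_le_iff₀ hY, abs_le]
    have := hf x hx
    have := hf y hy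
    constructor <;> linarith
  have h1 := hd x hx
  have h2 := hd y hy
  rw [dist_comm] at h2
  have := dist_triangle4 x (v + (f x / Y) • (z - v)) (v + (f y / Y) • (z - v)) y
  linarith

/-- Heights of the points of `P` above the corner `v`, in direction `u`: the apex `z` has the largest
height `Y`, and the cut at height `t` separates a piece of relative area `a`. -/
structure CornerCut (P : Set Plane) (u v z : Plane) (Y t a : ℝ) : Prop where
  polygon : IsConvexPolygon P
  unit : ‖u‖ = 1
  v_mem : v ∈ P
  z_mem : z ∈ P
  height_nonneg : ∀ x ∈ P, 0 ≤ inner ℝ u (x - v)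
  height_le : ∀ x ∈ P, inner ℝ u (x - v) ≤ Y
  height_z : inner ℝ u (z - v) = Y
  a_pos : 0 < a
  a_le : a ≤ 1 / 2
  area_left : area (P ∩ {x | inner ℝ u (x - v) ≤ t}) = a * area P
  area_right : area (P ∩ {x | t ≤ inner ℝ u (x - v)}) = (1 - a) * area P

namespace CornerCut

variable {P : Set Plane} {u v z : Plane} {Y t a : ℝ}

theorem t_nonneg (h : CornerCut P u v z Y t a) : 0 ≤ t := by
  have h1 := h.area_left
  have : (P ∩ {x | inner ℝ u (x - v) ≤ t}).Nonempty := by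
    rw [nonempty_iff_ne_empty]
    intro h0
    rw [h0] at h1
    have := mul_pos h.a_pos h.polygon.area_pos
    simp [area] at h1 this
    rcases h1 with h1 | h1 <;> simp [h1] at this
  obtain ⟨x, hx, hxt⟩ := this
  exact (h.height_nonneg x hx).trans hxt

theorem t_le (h : CornerCut P u v z Y t a) : t ≤ Y := by
  have h1 := h.area_right
  have : (P ∩ {x | t ≤ inner ℝ u (x - v)}).Nonempty := by
    rw [nonempty_iff_ne_empty]
    intro h0
    rw [h0] at h1
    have := mul_pos (show 0 < 1 - a by linarith [h.a_le]) h.polygon.area_pos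
    rw [← h1] at this
    simp [area] at this
  obtain ⟨x, hx, hxt⟩ := this
  exact le_trans hxt (h.height_le x hx)

theorem Y_pos (h : CornerCut P u v z Y t a) : 0 < Y := by
  by_contra hY
  have hsub : P ⊆ {x | inner ℝ u x = inner ℝ u v} := by
    intro x hx
    have h1 := h.height_nonneg x hx
    have h2 := h.height_le x hx
    rw [inner_sub_right] at h1 h2
    exact le_antisymm (by linarith) (by linarith)
  have h0 := h.polygon.area_pos
  rw [area, Measure.real, measure_mono_null hsub (volume_line u
    (norm_pos_iff.1 (by rw [h.unit]; exact one_pos)) _)] at h0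
  simp at h0

theorem homothety_subset (h : CornerCut P u v z Y t a) {x : Plane} (hx : x ∈ P) {r : ℝ}
    (h0 : 0 ≤ r) (h1 : r ≤ 1) : AffineMap.homothety x r '' P ⊆ P := by
  rintro _ ⟨y, hy, rfl⟩
  rw [AffineMap.homothety_eq_lineMap]
  exact h.polygon.convex.lineMap_mem hx hy ⟨h0, h1⟩

theorem height_homothety (x y : Plane) (r : ℝ) :
    inner ℝ u (AffineMap.homothety x r y - v) =
      (1 - r) * inner ℝ u (x - v) + r * inner ℝ u (y - v) := by
  rw [AffineMap.homothety_apply]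
  have : (r • (y -ᵥ x) +ᵥ x) - v = (1 - r) • (x - v) + r • (y - v) := by
    simp only [vsub_eq_sub, vadd_eq_add]; module
  rw [this, inner_add_right, inner_smul_right, inner_smul_right]

/-- The copy of `P` shrunk towards `v` by the factor `t / Y` fits into the lower piece; compare
areas. -/
theorem sq_t_le (h : CornerCut P u v z Y t a) : t ^ 2 ≤ a * Y ^ 2 := by
  have hY := h.Y_pos
  have hr0 : 0 ≤ t / Y := div_nonneg h.t_nonneg hY.le
  have hsub : AffineMap.homothety v (t / Y) '' P ⊆ P ∩ {x | inner ℝ u (x - v) ≤ t} := by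
    refine subset_inter (h.homothety_subset h.v_mem hr0 ((div_le_one hY).2 h.t_le)) ?_
    rintro _ ⟨y, hy, rfl⟩
    change inner ℝ u _ ≤ t
    rw [height_homothety, sub_self, inner_zero_right, mul_zero, zero_add]
    calc t / Y * inner ℝ u (y - v) ≤ t / Y * Y := by gcongr; exact h.height_le y hy
      _ = t := by field_simp
  have h1 := area_mono (h.polygon.isCompact.inter_right
    (isClosed_le (by fun_prop) continuous_const)) hsub
  rw [area_homothety, h.area_left] at h1
  have h2 := le_of_mul_le_mul_right h1 h.polygon.area_pos
  rwa [div_pow, div_le_iff₀ (by positivity)] at h2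

/-- The same comparison for the copy shrunk towards the apex `z`. -/
theorem sq_sub_t_le (h : CornerCut P u v z Y t a) : (Y - t) ^ 2 ≤ (1 - a) * Y ^ 2 := by
  have hY := h.Y_pos
  have ht := h.t_nonneg
  have htY := h.t_le
  have hr0 : 0 ≤ (Y - t) / Y := div_nonneg (by linarith) hY.le
  have hsub : AffineMap.homothety z ((Y - t) / Y) '' P ⊆ P ∩ {x | t ≤ inner ℝ u (x - v)} := by
    refine subset_inter (h.homothety_subset h.z_mem hr0 ((div_le_one hY).2 (by linarith))) ?_
    rintro _ ⟨y, hy, rfl⟩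
    change t ≤ inner ℝ u _
    rw [height_homothety, h.height_z]
    have h1 := mul_nonneg hr0 (h.height_nonneg y hy)
    have h2 : (1 - (Y - t) / Y) * Y = t := by field_simp; ring
    linarith
  have h1 := area_mono (h.polygon.isCompact.inter_right
    (isClosed_le continuous_const (by fun_prop))) hsub
  rw [area_homothety, h.area_right] at h1
  have h2 := le_of_mul_le_mul_right h1 h.polygon.area_pos
  rwa [div_pow, div_le_iff₀ (by positivity)] at h2

/-- Follows from `sq_sub_t_le`, since `(1 - a/2)² > 1 - a`. -/
theorem le_t (h : CornerCut P u v z Y t a) : a / 2 * Y ≤ t := by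
  have h1 := h.sq_sub_t_le
  have hY := h.Y_pos
  have ha := h.a_pos
  by_contra! hlt
  nlinarith [h.t_nonneg, mul_pos hY hY, mul_pos ha hY]

theorem t_pos (h : CornerCut P u v z Y t a) : 0 < t :=
  (mul_pos (half_pos h.a_pos) h.Y_pos).trans_le h.le_t

theorem Y_le_diam (h : CornerCut P u v z Y t a) : Y ≤ Metric.diam P := by
  rw [← h.height_z]
  refine (real_inner_le_norm _ _).trans ?_
  rw [h.unit, one_mul, ← dist_eq_norm]
  exact Metric.dist_le_diam_of_mem h.polygon.isCompact.isBounded h.z_mem h.v_mem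

theorem dist_homothety (x y y' : Plane) {r : ℝ} (hr : 0 ≤ r) :
    dist (AffineMap.homothety x r y) (AffineMap.homothety x r y') = r * dist y y' := by
  simp only [AffineMap.homothety_apply, vsub_eq_sub, vadd_eq_add]
  rw [dist_add_right, dist_smul₀, dist_sub_right, Real.norm_of_nonneg hr]

theorem spine_mem (h : CornerCut P u v z Y t a) {x : Plane} (hx : x ∈ P) :
    v + (inner ℝ u (x - v) / Y) • (z - v) ∈ P ∧
      inner ℝ u (v + (inner ℝ u (x - v) / Y) • (z - v) - v) = inner ℝ u (x - v) := by
  have hY := h.Y_pos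
  refine ⟨h.polygon.convex.add_smul_sub_mem h.v_mem h.z_mem
    ⟨div_nonneg (h.height_nonneg x hx) hY.le, (div_le_one hY).2 (h.height_le x hx)⟩, ?_⟩
  rw [add_sub_cancel_left, inner_smul_right, h.height_z]
  field_simp

/-- If the chord at height `t` is short, then all pieces above it are narrow. -/
theorem dist_le_right (h : CornerCut P u v z Y t a) {κ : ℝ} (hκ : 0 < κ)
    (hs : ∀ p ∈ P, ∀ q ∈ P, inner ℝ u (p - v) = t → inner ℝ u (q - v) = t → dist p q ≤ t / κ)
    {x x' : Plane} (hx : x ∈ P) (hx' : x' ∈ P) (hxt : t ≤ inner ℝ u (x - v))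
    (hxx : inner ℝ u (x' - v) = inner ℝ u (x - v)) : dist x x' ≤ Y / κ := by
  have ht := h.t_pos
  set y := inner ℝ u (x - v) with hy
  have hy0 : 0 < y := ht.trans_le hxt
  have hr0 : 0 ≤ t / y := (div_pos ht hy0).le
  have hsub := h.homothety_subset h.v_mem hr0 ((div_le_one hy0).2 hxt)
  have h1 := hs _ (hsub (mem_image_of_mem _ hx)) _ (hsub (mem_image_of_mem _ hx'))
    (by rw [height_homothety, ← hy]; simp; field_simp)
    (by rw [height_homothety, hxx]; simp; field_simp)
  rw [dist_homothety _ _ _ hr0, div_mul_eq_mul_div, div_le_div_iff₀ hy0 hκ] at h1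
  have h2 : dist x x' * κ ≤ y := by
    refine le_of_mul_le_mul_left ?_ ht
    linarith
  rw [le_div_iff₀ hκ]
  exact h2.trans (h.height_le x hx)

/-- Shrinking towards the apex `z` carries a chord below height `t` to one at height `t`, with a
ratio bounded below. -/
theorem dist_le_left (h : CornerCut P u v z Y t a) {κ : ℝ}
    (hs : ∀ p ∈ P, ∀ q ∈ P, inner ℝ u (p - v) = t → inner ℝ u (q - v) = t → dist p q ≤ t / κ)
    {x x' : Plane} (hx : x ∈ P) (hx' : x' ∈ P) (hxt : inner ℝ u (x - v) ≤ t)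
    (hxx : inner ℝ u (x' - v) = inner ℝ u (x - v)) : dist x x' ≤ 7 / 2 * (t / κ) := by
  have hY := h.Y_pos
  -- `a ≤ 1/2` gives `t² ≤ Y²/2`, hence `t ≤ (5/7) Y` because `(5/7)² > 1/2`.
  have htY : 2 / 7 * Y ≤ Y - t := by
    have h1 := h.sq_t_le
    have h2 := h.a_le
    by_contra! hlt
    nlinarith [h.t_nonneg, mul_pos hY hY]
  set y := inner ℝ u (x - v) with hy
  have hy0 : 0 ≤ y := h.height_nonneg x hx
  have hYy : 0 < Y - y := by linarith
  have hr0 : 0 ≤ (Y - t) / (Y - y) := div_nonneg (by linarith) hYy.le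
  have hsub := h.homothety_subset h.z_mem hr0 ((div_le_one hYy).2 (by linarith))
  have h1 := hs _ (hsub (mem_image_of_mem _ hx)) _ (hsub (mem_image_of_mem _ hx'))
    (by rw [height_homothety, ← hy, h.height_z]; field_simp; ring)
    (by rw [height_homothety, hxx, h.height_z]; field_simp; ring)
  rw [dist_homothety _ _ _ hr0] at h1
  have h2 : 2 / 7 ≤ (Y - t) / (Y - y) := by
    rw [le_div_iff₀ hYy]; linarith
  have h3 := mul_le_mul_of_nonneg_right h2 (dist_nonneg (x := x) (y := x'))
  linarith

/-- The piece stays near the part of the segment `v z` at heights in `[0, t]`, and `t ≤ √a * Y`. The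
`7` is twice the `7/2` of `dist_le_left`. -/
theorem diam_left_le (h : CornerCut P u v z Y t a) {κ : ℝ} (hκ : 0 < κ)
    (hs : ∀ p ∈ P, ∀ q ∈ P, inner ℝ u (p - v) = t → inner ℝ u (q - v) = t → dist p q ≤ t / κ) :
    Metric.diam (P ∩ {x | inner ℝ u (x - v) ≤ t}) ≤ √a * Metric.diam P * (1 + 7 / κ) := by
  have hY := h.Y_pos
  have ht := h.t_pos
  have hta : t ≤ √a * Y := by
    rw [← Real.sqrt_sq hY.le, ← Real.sqrt_mul h.a_pos.le]
    exact Real.le_sqrt_of_sq_le h.sq_t_le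
  have h1 := diam_le_of_near_segment (Q := P ∩ {x | inner ℝ u (x - v) ≤ t})
    h.polygon.isCompact.isBounded h.v_mem h.z_mem (f := fun x => inner ℝ u (x - v)) (r := √a)
    (W := 7 / 2 * (t / κ)) (α := 0) hY (Real.sqrt_nonneg _) (by positivity)
    (fun x hx => h.dist_le_left hs hx.1 (h.spine_mem hx.1).1 hx.2 (h.spine_mem hx.1).2)
    (fun x hx => ⟨h.height_nonneg x hx.1, by
      have : inner ℝ u (x - v) ≤ t := hx.2
      linarith⟩)
  have h2 : t / κ ≤ √a * Metric.diam P / κ := by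
    gcongr
    exact hta.trans (by gcongr; exact h.Y_le_diam)
  have h3 : √a * Metric.diam P * (1 + 7 / κ) = √a * Metric.diam P + 7 * (√a * Metric.diam P / κ) := by
    ring
  rw [h3]
  linarith

theorem diam_right_le (h : CornerCut P u v z Y t a) {κ : ℝ} (hκ : 0 < κ)
    (hs : ∀ p ∈ P, ∀ q ∈ P, inner ℝ u (p - v) = t → inner ℝ u (q - v) = t → dist p q ≤ t / κ) :
    Metric.diam (P ∩ {x | t ≤ inner ℝ u (x - v)}) ≤ √(1 - a) * Metric.diam P * (1 + 7 / κ) := by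
  have hY := h.Y_pos
  have ht := h.t_pos
  have ha := h.a_le
  have hta : Y - t ≤ √(1 - a) * Y := by
    rw [← Real.sqrt_sq hY.le, ← Real.sqrt_mul (by linarith), Real.sqrt_sq hY.le]
    exact Real.le_sqrt_of_sq_le h.sq_sub_t_le
  have h1 := diam_le_of_near_segment (Q := P ∩ {x | t ≤ inner ℝ u (x - v)})
    h.polygon.isCompact.isBounded h.v_mem h.z_mem (f := fun x => inner ℝ u (x - v)) (r := √(1 - a))
    (W := Y / κ) (α := t) hY (Real.sqrt_nonneg _) (by positivity)
    (fun x hx => h.dist_le_right hκ hs hx.1 (h.spine_mem hx.1).1 hx.2 (h.spine_mem hx.1).2)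
    (fun x hx => ⟨hx.2, by
      have := h.height_le x hx.1
      linarith⟩)
  -- The width error must be proportional to `√(1 - a)`, which is bounded below as `a ≤ 1/2`.
  have hsq : 1 / 2 ≤ √(1 - a) := Real.le_sqrt_of_sq_le (by linarith)
  have h2 : Y / κ ≤ Metric.diam P / κ := by
    gcongr
    exact h.Y_le_diam
  have h4 : 1 / 2 * (Metric.diam P / κ) ≤ √(1 - a) * (Metric.diam P / κ) := by
    gcongr
  have h5 : 0 ≤ Metric.diam P / κ := div_nonneg Metric.diam_nonneg hκ.le
  have h3 : √(1 - a) * Metric.diam P * (1 + 7 / κ) =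
    √(1 - a) * Metric.diam P + 7 * (√(1 - a) * (Metric.diam P / κ)) := by ring
  rw [h3]
  linarith

end CornerCut

theorem one_add_sq_le {k : ℝ} (hk : 3 ≤ k) : (1 + 7 / (4 / 3 * k ^ 2)) ^ 2 ≤ 1 + 6 / k := by
  have h1 : 7 / (4 / 3 * k ^ 2) ≤ 7 / 4 * (1 / k) := by
    rw [div_le_iff₀ (by positivity)]
    field_simp
    linarith
  have h2 : 1 / k ≤ 1 / 3 := one_div_le_one_div_of_le (by norm_num) hk
  have h3 : 0 ≤ 1 / k := by positivity
  have h4 : 0 ≤ 7 / (4 / 3 * k ^ 2) := by positivity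
  have h5 : 6 / k = 6 * (1 / k) := by ring
  rw [h5]
  nlinarith

/-- The cut goes across the bisector of a corner that is not too flat; a short and a long chord are
treated separately. -/
theorem exists_good_cut {P : Set Plane} (h : IsConvexPolygon P) {k : ℕ} (hk3 : 3 ≤ k)
    (hk : numVertices P ≤ k) {a : ℝ} (ha : 0 < a) (ha2 : a ≤ 1 / 2) :
    ∃ P₁ P₂, IsCut P (a * area P) ((1 - a) * area P) P₁ P₂ ∧
      max (aspectRatio P₁) (aspectRatio P₂) ≤ max (aspectRatio P * (1 + 6 / (k : ℝ))) ((k : ℝ) ^ 8) := by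
  have hA := h.area_pos
  have hkR : (3 : ℝ) ≤ k := by exact_mod_cast hk3
  obtain ⟨v, hv, u, hu, hcorner⟩ := exists_corner h hk3 hk
  have hu0 : u ≠ 0 := norm_pos_iff.1 (by rw [hu]; exact one_pos)
  obtain ⟨c, hc⟩ := exists_cut_direction h.isCompact (mul_pos ha hA)
    (by nlinarith : a * area P < area P) hu0
  have hcut := isCut_halfplanes h.isCompact (a₂ := (1 - a) * area P) (by ring) hu0 hc
  set t := c - inner ℝ u v with ht_def
  have eL : {x : Plane | inner ℝ u x ≤ c} = {x | inner ℝ u (x - v) ≤ t} := by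
    ext x; simp [inner_sub_right, ht_def]
  have eR : {x : Plane | c ≤ inner ℝ u x} = {x | t ≤ inner ℝ u (x - v)} := by
    ext x; simp [inner_sub_right, ht_def]
  rw [eL, eR] at hcut
  obtain ⟨z, hz, hzmax⟩ := h.isCompact.exists_isMaxOn h.nonempty
    (f := fun x => inner ℝ u (x - v)) (by fun_prop)
  have H : CornerCut P u v z (inner ℝ u (z - v)) t a :=
    ⟨h, hu, hv, hz, fun x hx => (hcorner x hx).1, fun x hx => hzmax hx, rfl, ha, ha2,
      hcut.2.1, hcut.2.2⟩
  generalize inner ℝ u (z - v) = Y at H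
  refine ⟨_, _, hcut, ?_⟩
  set P₁ := P ∩ {x | inner ℝ u (x - v) ≤ t} with hP₁
  set P₂ := P ∩ {x | t ≤ inner ℝ u (x - v)} with hP₂
  set D := Metric.diam P with hD
  have hD0 : 0 ≤ D := Metric.diam_nonneg
  have ht0 := H.t_pos
  -- Order `k²` makes `7 / κ` small enough for the factor `1 + 6/k` and keeps the polynomial bounds
  -- in the long-chord case below `k⁸`.
  set κ : ℝ := 4 / 3 * (k : ℝ) ^ 2 with hκdef
  have hκ : 0 < κ := by positivity
  by_cases hs : ∀ p ∈ P, ∀ q ∈ P, inner ℝ u (p - v) = t → inner ℝ u (q - v) = t →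
      dist p q ≤ t / κ
  · have key : ∀ {Q : Set Plane} {b : ℝ}, 0 < b → area Q = b * area P →
        Metric.diam Q ≤ √b * D * (1 + 7 / κ) → aspectRatio Q ≤ aspectRatio P * (1 + 6 / (k : ℝ)) := by
      intro Q b hb hQ hd
      rw [aspectRatio, aspectRatio, hQ, div_mul_eq_mul_div, div_le_div_iff₀ (by positivity) hA]
      have h1 : Metric.diam Q ^ 2 ≤ (√b * D * (1 + 7 / κ)) ^ 2 := by
        gcongr
      rw [mul_pow, mul_pow, Real.sq_sqrt hb.le] at h1
      have h2 := mul_le_mul_of_nonneg_left (one_add_sq_le hkR) (show 0 ≤ b * D ^ 2 by positivity)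
      have h3 := mul_le_mul_of_nonneg_right (h1.trans h2) hA.le
      linarith
    refine le_max_of_le_left (max_le ?_ ?_)
    · exact key ha H.area_left (H.diam_left_le hκ hs)
    · exact key (by linarith) H.area_right (H.diam_right_le hκ hs)
  push Not at hs
  obtain ⟨p, hp, q, hq, hpt, hqt, hpq⟩ := hs
  -- Long chord: the triangle over it with apex `v` lies in the lower piece, which has area `a *
  -- area P`.
  have harea : t ^ 2 ≤ 2 * κ * (a * area P) := by
    have h1 := chord_mul_height_le_area (Q := P₁) (h.isCompact.inter_right
      (isClosed_le (by fun_prop) continuous_const))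
      (h.convex.inter (by rw [← eL]; exact convex_halfplane_le u c)) hu ht0.le
      (⟨hv, by simpa using ht0.le⟩ : v ∈ P₁) ⟨hp, hpt.le⟩ ⟨hq, hqt.le⟩ hpt hqt
    rw [H.area_left] at h1
    rw [div_lt_iff₀ hκ] at hpq
    nlinarith
  have hball : ∀ x ∈ P, ∀ y ∈ P, ∀ s, inner ℝ u (x - v) ≤ s → inner ℝ u (y - v) ≤ s →
      dist x y ≤ 5 * k * s := by
    intro x hx y hy s hxs hys
    have h1 := (hcorner x hx).2
    have h2 := (hcorner y hy).2
    have h3 : 5 / 2 * (k : ℝ) * inner ℝ u (x - v) ≤ 5 / 2 * k * s := by gcongr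
    have h4 : 5 / 2 * (k : ℝ) * inner ℝ u (y - v) ≤ 5 / 2 * k * s := by gcongr
    rw [← dist_eq_norm] at h1 h2
    have := dist_triangle_right x y v
    linarith
  have hk2 : (9 : ℝ) ≤ (k : ℝ) ^ 2 := by nlinarith
  refine max_le (le_max_of_le_right ?_) ?_
  · have h1 : Metric.diam P₁ ≤ 5 * k * t := Metric.diam_le_of_forall_dist_le (by positivity)
      fun x hx y hy => hball x hx.1 y hy.1 t hx.2 hy.2
    rw [aspectRatio, H.area_left, div_le_iff₀ (by positivity)]
    calc Metric.diam P₁ ^ 2 ≤ (5 * k * t) ^ 2 := by gcongr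
      _ = 25 * (k : ℝ) ^ 2 * t ^ 2 := by ring
      _ ≤ 25 * (k : ℝ) ^ 2 * (2 * κ * (a * area P)) := by gcongr
      _ = 200 / 3 * (k : ℝ) ^ 4 * (a * area P) := by rw [hκdef]; ring
      _ ≤ (k : ℝ) ^ 4 * (k : ℝ) ^ 4 * (a * area P) := by
        have : (200 / 3 : ℝ) ≤ (k : ℝ) ^ 4 := by nlinarith
        gcongr
      _ = _ := by ring
  have hdP₂ : Metric.diam P₂ ≤ D := Metric.diam_mono inter_subset_left h.isCompact.isBounded
  rw [aspectRatio, H.area_right]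
  have hsq2 : Metric.diam P₂ ^ 2 ≤ D ^ 2 := by gcongr
  -- This is the threshold at which `(1 + 6/k) (1 - a) ≥ 1`: below it the loss of area alone is
  -- harmless, even if the diameter does not drop.
  by_cases hak : a * (k + 6) ≤ 6
  · refine le_max_of_le_left ?_
    rw [aspectRatio, div_mul_eq_mul_div, div_le_div_iff₀ (mul_pos (by linarith) hA) hA]
    have h1 : 1 ≤ (1 + 6 / (k : ℝ)) * (1 - a) := by
      have : (1 + 6 / (k : ℝ)) * (1 - a) = (k + 6) * (1 - a) / k := by field_simp
      rw [this, le_div_iff₀ (by linarith)]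
      linarith
    calc Metric.diam P₂ ^ 2 * area P ≤ D ^ 2 * area P * 1 := by
          rw [mul_one]; gcongr
      _ ≤ D ^ 2 * area P * ((1 + 6 / (k : ℝ)) * (1 - a)) := by gcongr
      _ = _ := by ring
  · refine le_max_of_le_right ?_
    push Not at hak
    -- `a ≤ 1/2` and `a (k + 6) > 6` force `k > 6`.
    have hk7 : (7 : ℝ) ≤ k := by
      have h1 : (6 : ℝ) < k := by nlinarith
      have h2 : 6 < k := by exact_mod_cast h1
      exact_mod_cast h2
    have hY : a * Y ≤ 2 * t := by linarith [H.le_t]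
    have hDY : D ≤ 5 * k * Y := by
      have := H.Y_pos
      exact Metric.diam_le_of_forall_dist_le (by positivity)
        fun x hx y hy => hball x hx y hy Y (H.height_le x hx) (H.height_le y hy)
    have haD : a * D ≤ 10 * k * t := by
      have := mul_le_mul_of_nonneg_left hDY ha.le
      nlinarith
    have h3 : a ^ 2 * D ^ 2 ≤ 800 / 3 * (k : ℝ) ^ 4 * (a * area P) := by
      calc a ^ 2 * D ^ 2 = (a * D) ^ 2 := by ring
        _ ≤ (10 * k * t) ^ 2 := by gcongr
        _ = 100 * (k : ℝ) ^ 2 * t ^ 2 := by ring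
        _ ≤ 100 * (k : ℝ) ^ 2 * (2 * κ * (a * area P)) := by gcongr
        _ = _ := by rw [hκdef]; ring
    have h4 : a * D ^ 2 ≤ 800 / 3 * (k : ℝ) ^ 4 * area P := by
      refine le_of_mul_le_mul_left ?_ ha
      linarith
    -- Here `a (k + 6) > 6` removes the remaining factor `a`.
    have h5 : 6 * D ^ 2 ≤ (k + 6) * (800 / 3 * (k : ℝ) ^ 4 * area P) := by
      have h7 := mul_le_mul_of_nonneg_left h4 (show (0 : ℝ) ≤ k + 6 by linarith)
      have h8 := mul_le_mul_of_nonneg_right hak.le (sq_nonneg D)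
      linarith
    have h6 : (k + 6) * (800 / 3) ≤ 3 * (k : ℝ) ^ 4 := by
      have : (343 : ℝ) ≤ (k : ℝ) ^ 3 := by
        calc (343 : ℝ) = 7 ^ 3 := by norm_num
          _ ≤ _ := by gcongr
      have : 343 * (k : ℝ) ≤ (k : ℝ) ^ 3 * k := by gcongr
      have h7 : (k : ℝ) ^ 4 = (k : ℝ) ^ 3 * k := by ring
      rw [h7]
      linarith
    have h8 : (k + 6) * (800 / 3) * ((k : ℝ) ^ 4 * area P) ≤
        3 * (k : ℝ) ^ 4 * ((k : ℝ) ^ 4 * area P) := by gcongr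
    rw [div_le_iff₀ (mul_pos (by linarith) hA)]
    calc Metric.diam P₂ ^ 2 ≤ D ^ 2 := hsq2
      _ ≤ (k : ℝ) ^ 8 * (1 / 2 * area P) := by
        have e1 : (k + 6) * (800 / 3 * (k : ℝ) ^ 4 * area P) =
          (k + 6) * (800 / 3) * ((k : ℝ) ^ 4 * area P) := by ring
        have e2 : 3 * (k : ℝ) ^ 4 * ((k : ℝ) ^ 4 * area P) =
          6 * ((k : ℝ) ^ 8 * (1 / 2 * area P)) := by ring
        linarith
      _ ≤ _ := by gcongr; linarith

/-! ### Greedy cuts of fat polygons -/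

/-- The binomial term `8 k⁷` absorbs `6 k⁷`. -/
theorem pow_eight_mul_le {k : ℝ} (hk : 0 < k) : k ^ 8 * (1 + 6 / k) ≤ (k + 1) ^ 8 := by
  have h1 : k ^ 8 * (1 + 6 / k) = k ^ 8 + 6 * k ^ 7 := by field_simp
  have h2 : (k + 1) ^ 8 - (k ^ 8 + 6 * k ^ 7) =
    2 * k ^ 7 + 28 * k ^ 6 + 56 * k ^ 5 + 70 * k ^ 4 + 56 * k ^ 3 + 28 * k ^ 2 + 8 * k + 1 := by ring
  have h3 : 0 ≤ 2 * k ^ 7 + 28 * k ^ 6 + 56 * k ^ 5 + 70 * k ^ 4 + 56 * k ^ 3 + 28 * k ^ 2 + 8 * k + 1 := by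
    positivity
  linarith

theorem exists_cut_aspectRatio_le {R : Set Plane} (hR : IsConvexPolygon R) {k : ℕ}
    (hk : numVertices R ≤ k) (har : aspectRatio R ≤ (k : ℝ) ^ 8) {a₁ a₂ : ℝ} (h₁ : 0 < a₁)
    (h₂ : 0 < a₂) (ha : a₁ + a₂ = area R) :
    ∃ Q₁ Q₂, IsCut R a₁ a₂ Q₁ Q₂ ∧ max (aspectRatio Q₁) (aspectRatio Q₂) ≤ ((k : ℝ) + 1) ^ 8 := by
  wlog hle : a₁ ≤ a₂ generalizing a₁ a₂
  · obtain ⟨Q₁, Q₂, hQ, hb⟩ := this h₂ h₁ (by linarith) (not_le.1 hle).le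
    exact ⟨Q₂, Q₁, hQ.symm, by rwa [max_comm]⟩
  have hA := hR.area_pos
  have hk3 : 3 ≤ k := hR.three_le_numVertices.trans hk
  have hkR : (0 : ℝ) < k := by exact_mod_cast (by omega : 0 < k)
  obtain ⟨Q₁, Q₂, hQ, hb⟩ := exists_good_cut hR hk3 hk (a := a₁ / area R) (by positivity)
    (by rw [div_le_iff₀ hA]; linarith)
  rw [sub_mul, one_mul, div_mul_cancel₀ _ hA.ne', ← ha, add_sub_cancel_left] at hQ
  refine ⟨Q₁, Q₂, hQ, hb.trans (max_le ?_ ?_)⟩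
  · refine le_trans ?_ (pow_eight_mul_le hkR)
    gcongr
  · gcongr
    linarith

/-- One step of the invariant: a greedy cut is at least as good as the cut from the good cuts lemma.
-/
theorem IsGreedyCut.bound {R R₁ R₂ : Set Plane} (hR : IsConvexPolygon R) {k : ℕ}
    (hk : numVertices R ≤ k) (har : aspectRatio R ≤ (k : ℝ) ^ 8) {a₁ a₂ : ℝ} (h₁ : 0 < a₁)
    (h₂ : 0 < a₂) (ha : a₁ + a₂ = area R) (hcut : IsGreedyCut R a₁ a₂ R₁ R₂) :
    (IsConvexPolygon R₁ ∧ numVertices R₁ ≤ k + 1 ∧ aspectRatio R₁ ≤ ((k + 1 : ℕ) : ℝ) ^ 8) ∧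
      IsConvexPolygon R₂ ∧ numVertices R₂ ≤ k + 1 ∧ aspectRatio R₂ ≤ ((k + 1 : ℕ) : ℝ) ^ 8 := by
  obtain ⟨⟨p1, n1⟩, p2, n2⟩ := hcut.1.isConvexPolygon hR h₁ h₂
  obtain ⟨Q₁, Q₂, hQ, hb⟩ := exists_cut_aspectRatio_le hR hk har h₁ h₂ ha
  have h3 := (hcut.2 Q₁ Q₂ hQ).trans hb
  push_cast
  exact ⟨⟨p1, by omega, (le_max_left _ _).trans h3⟩, p2, by omega, (le_max_right _ _).trans h3⟩

/-! ### The unit square -/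

theorem unitSquare_eq : unitSquare =
    convexHull ℝ (({!₂[0, 0], !₂[1, 0], !₂[0, 1], !₂[1, 1]} : Finset Plane) : Set Plane) := by
  apply Subset.antisymm
  · intro x hx
    have h0 := hx 0
    have h1 := hx 1
    have hs := subset_convexHull ℝ
      (({!₂[0, 0], !₂[1, 0], !₂[0, 1], !₂[1, 1]} : Finset Plane) : Set Plane)
    have hc := convex_convexHull ℝ
      (({!₂[0, 0], !₂[1, 0], !₂[0, 1], !₂[1, 1]} : Finset Plane) : Set Plane)
    have hb := hc (hs (by simp : (!₂[0, 0] : Plane) ∈ _)) (hs (by simp : (!₂[1, 0] : Plane) ∈ _))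
      (by linarith : 0 ≤ 1 - x 0) h0.1 (by ring)
    have ht := hc (hs (by simp : (!₂[0, 1] : Plane) ∈ _)) (hs (by simp : (!₂[1, 1] : Plane) ∈ _))
      (by linarith : 0 ≤ 1 - x 0) h0.1 (by ring)
    have := hc hb ht (by linarith : 0 ≤ 1 - x 1) h1.1 (by ring)
    convert this using 1
    ext i; fin_cases i <;> simp <;> ring
  · refine convexHull_min ?_ ?_
    · intro x hx i
      simp only [Finset.coe_insert, Finset.coe_singleton, mem_insert_iff, mem_singleton_iff] at hx
      rcases hx with rfl | rfl | rfl | rfl <;> fin_cases i <;> simp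
    · intro x hx y hy a b ha hb hab i
      have h1 := hx i
      have h2 := hy i
      simp only [PiLp.add_apply, PiLp.smul_apply, smul_eq_mul]
      constructor <;> nlinarith

theorem isConvexPolygon_unitSquare : IsConvexPolygon unitSquare :=
  ⟨⟨_, unitSquare_eq⟩, interior_nonempty_of_area_pos
    (by rw [unitSquare_eq]; exact convex_convexHull ℝ _) (by rw [area_unitSquare]; exact one_pos)⟩

theorem numVertices_unitSquare_le : numVertices unitSquare ≤ 4 := by
  rw [numVertices, unitSquare_eq]
  refine (ncard_le_ncard extremePoints_convexHull_subset (Finset.finite_toSet _)).trans ?_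
  rw [ncard_coe_finset]
  exact Finset.card_le_four

theorem aspectRatio_unitSquare_le : aspectRatio unitSquare ≤ ((4 : ℕ) : ℝ) ^ 8 := by
  rw [aspectRatio, area_unitSquare, div_one]
  have h : Metric.diam unitSquare ≤ 2 := by
    refine Metric.diam_le_of_forall_dist_le (by norm_num) fun x hx y hy => ?_
    rw [EuclideanSpace.dist_eq, Real.sqrt_le_left (by norm_num)]
    simp only [Fin.sum_univ_two, Real.dist_eq, sq_abs]
    have := hx 0
    have := hx 1
    have := hy 0
    have := hy 1
    nlinarith
  calc Metric.diam unitSquare ^ 2 ≤ 2 ^ 2 := by gcongr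
    _ ≤ _ := by norm_num

/-! ### Rooted trees -/

open Classical in
-- Among nonempty proper subsets of `C \ {μ}` with at most half the total, take one of largest
-- cardinality. If its complement were too heavy, another element could be moved into it, since no
-- element outweighs `μ`.
theorem exists_balanced_split {ι : Type*} {C : Finset ι} (hC : 3 ≤ C.card) {f : ι → ℕ} {μ : ι} (hμ : μ ∈ C)
    (hmax : ∀ u ∈ C, f u ≤ f μ) :
    ∃ C₁ C₂ : Finset ι, C₁ ∪ C₂ = C \ {μ} ∧ Disjoint C₁ C₂ ∧ C₁.Nonempty ∧ C₂.Nonempty ∧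
      2 * ∑ u ∈ C₁, f u < 1 + ∑ u ∈ C, f u ∧
      2 * ∑ u ∈ C₂, f u < 1 + ∑ u ∈ C, f u := by
  set D := C \ {μ} with hD
  have hDcard : 2 ≤ D.card := by
    rw [hD, Finset.card_sdiff_of_subset (by simpa using hμ), Finset.card_singleton]; omega
  have hsum : ∑ u ∈ C, f u = ∑ u ∈ D, f u + f μ := by
    rw [hD, ← Finset.sum_sdiff (s₁ := {μ}) (by simpa using hμ), Finset.sum_singleton]
  set S := ∑ u ∈ C, f u with hS
  set F : Finset (Finset ι) := D.powerset.filter fun E =>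
    E.Nonempty ∧ E ≠ D ∧ 2 * ∑ u ∈ E, f u ≤ S with hF
  have hsingle : ∀ x ∈ D, 2 * f x ≤ S := by
    intro x hx
    have h1 := hmax x (Finset.sdiff_subset hx)
    have h2 := Finset.single_le_sum (f := f)
      (fun _ _ => Nat.zero_le _) hx
    omega
  obtain ⟨x, hx⟩ : D.Nonempty := Finset.card_pos.1 (by omega)
  have hFne : F.Nonempty := by
    refine ⟨{x}, ?_⟩
    simp only [hF, Finset.mem_filter, Finset.mem_powerset, Finset.singleton_subset_iff,
      Finset.singleton_nonempty, Finset.sum_singleton, true_and]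
    refine ⟨hx, fun h => ?_, hsingle x hx⟩
    rw [← h, Finset.card_singleton] at hDcard
    omega
  obtain ⟨E, hE, hEmax⟩ := F.exists_max_image Finset.card hFne
  simp only [hF, Finset.mem_filter, Finset.mem_powerset] at hE
  obtain ⟨hED, hEne, hEneD, hES⟩ := hE
  have hsplit := Finset.sum_sdiff (f := f) hED
  refine ⟨E, D \ E, Finset.union_sdiff_of_subset hED, Finset.disjoint_sdiff, hEne, ?_, by omega, ?_⟩
  · rw [Finset.sdiff_nonempty]
    exact fun h => hEneD (hED.antisymm h)
  by_contra hbig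
  obtain ⟨y, hy⟩ : (D \ E).Nonempty := by
    rw [Finset.sdiff_nonempty]
    exact fun h => hEneD (hED.antisymm h)
  rw [Finset.mem_sdiff] at hy
  have hy1 := hmax y (Finset.sdiff_subset hy.1)
  have hins : ∑ u ∈ insert y E, f u = f y + ∑ u ∈ E, f u :=
    Finset.sum_insert hy.2
  have hmem : insert y E ∈ F := by
    simp only [hF, Finset.mem_filter, Finset.mem_powerset]
    refine ⟨Finset.insert_subset hy.1 hED, Finset.insert_nonempty _ _, fun h => ?_, by omega⟩
    -- The enlarged set could exhaust `D` only if the complement were one element, but `hsingle`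
    -- says that a single element is never too heavy.
    have h1 : D \ E = {y} := by
      rw [← h, Finset.insert_sdiff_of_notMem _ hy.2, Finset.sdiff_self, insert_empty_eq]
    rw [h1, Finset.sum_singleton] at hbig
    have := hsingle y hy.1
    omega
  have := hEmax _ hmem
  rw [Finset.card_insert_of_notMem hy.2] at this
  omega

section Tree

/-- The ancestors of `x` form a chain, so subtrees of distinct children are disjoint. -/
theorem eq_of_covBy_of_le {T : RootedTree} {ν u u' x : T} (hu : ν ⋖ u) (hu' : ν ⋖ u') (h : u ≤ x)
    (h' : u' ≤ x) : u = u' := by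
  rcases le_total_of_directed h h' with hle | hle
  · exact (hle.eq_of_not_lt (hu.2 hu'.lt)).symm
  · exact hle.eq_of_not_lt (hu'.2 hu.lt)

/-- The number of proper ancestors of a node. -/
noncomputable def level {T : RootedTree} (x : T) : ℕ := (Set.Iio x).ncard

theorem level_bot {T : RootedTree} : level (⊥ : T) = 0 := by
  simp [level]

variable {T : RootedTree} [Fintype T]

theorem mem_children {μ ν : T} : μ ∈ children ν ↔ ν ⋖ μ := by
  simp [children]

theorem le_iff_eq_or_exists_children {ν x : T} : ν ≤ x ↔ x = ν ∨ ∃ u ∈ children ν, u ≤ x := by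
  constructor
  · intro h
    rcases h.eq_or_lt with rfl | h
    · exact Or.inl rfl
    · obtain ⟨u, hu, hux⟩ := exists_covBy_le_of_lt h
      exact Or.inr ⟨u, mem_children.2 hu, hux⟩
  · rintro (rfl | ⟨u, hu, hux⟩)
    · exact le_rfl
    · exact (mem_children.1 hu).le.trans hux

theorem level_le_depth (x : T) : level x ≤ depth T :=
  Finset.le_sup (f := fun ν : T => (Set.Iio ν).ncard) (Finset.mem_univ x)

theorem level_mono {x y : T} (h : x ≤ y) : level x ≤ level y :=
  ncard_le_ncard (Set.Iio_subset_Iio h) (toFinite _)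

theorem level_of_covBy {x y : T} (h : x ⋖ y) : level y = level x + 1 := by
  have h1 : Set.Iio y = insert x (Set.Iio x) := by
    ext z
    simp only [mem_Iio, mem_insert_iff]
    refine ⟨fun hz => ?_, ?_⟩
    · have := Order.le_pred_of_lt hz
      rw [h.pred_eq] at this
      exact this.eq_or_lt
    · rintro (rfl | hz)
      · exact h.lt
      · exact hz.trans h.lt
  rw [level, h1, ncard_insert_of_notMem (by simp) (toFinite _), level]

theorem subtreeSize_pos (ν : T) : 0 < subtreeSize ν :=
  (ncard_pos (toFinite _)).2 ⟨ν, le_rfl⟩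

theorem subtreeSize_le_card (ν : T) : subtreeSize ν ≤ Fintype.card T := by
  rw [← Nat.card_eq_fintype_card, ← ncard_univ]
  exact ncard_le_ncard (subset_univ _) (toFinite _)

theorem subtreeSize_eq (ν : T) : subtreeSize ν = 1 + ∑ u ∈ children ν, subtreeSize u := by
  classical
  have hfin : ∀ u : T, subtreeSize u = (Finset.univ.filter fun x => u ≤ x).card := by
    intro u
    rw [subtreeSize, ← ncard_coe_finset]
    congr 1
    ext x; simp
  have h1 : (Finset.univ.filter fun x => ν ≤ x) =
      insert ν ((children ν).biUnion fun u => Finset.univ.filter fun x => u ≤ x) := by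
    ext x
    simpa using le_iff_eq_or_exists_children (ν := ν) (x := x)
  rw [hfin, h1, Finset.card_insert_of_notMem, Finset.card_biUnion, add_comm]
  · simp only [hfin]
  · intro u hu u' hu' hne
    rw [Function.onFun, Finset.disjoint_left]
    intro x hx hx'
    simp only [Finset.mem_filter, Finset.mem_univ, true_and] at hx hx'
    exact hne (eq_of_covBy_of_le (mem_children.1 hu) (mem_children.1 hu') hx hx')
  · simp only [Finset.mem_biUnion, Finset.mem_filter, Finset.mem_univ, true_and, not_exists, not_and]
    intro u hu
    exact (mem_children.1 hu).lt.not_ge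

/-! ### The transformation into a binary tree can be carried out -/

/-- Strong induction on the number of nodes strictly below the current one: passing to a child drops
the child itself, and passing to a group at least halves a positive number. -/
theorem exists_binarizes (n : ℕ) : ∀ (o : Option T) (C : Finset T),
    (C = ∅ → ∃ v, o = some v) → ∑ u ∈ C, subtreeSize u = n → ∃ t, Binarizes o C t := by
  classical
  induction n using Nat.strong_induction_on with
  | _ n ih =>
  intro o C ho hn
  have hchild : ∀ u ∈ C, ∃ t, Binarizes (some u) (children u) t := by
    intro u hu
    refine ih _ ?_ _ _ (fun _ => ⟨u, rfl⟩) rfl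
    have h1 := subtreeSize_eq u
    have h2 := Finset.single_le_sum (f := fun u : T => subtreeSize u)
      (fun _ _ => Nat.zero_le _) hu
    omega
  rcases Nat.lt_or_ge C.card 3 with hlt | hge
  · interval_cases hc : C.card
    · obtain rfl := Finset.card_eq_zero.1 hc
      obtain ⟨v, rfl⟩ := ho rfl
      exact ⟨_, .leaf v⟩
    · obtain ⟨u, rfl⟩ := Finset.card_eq_one.1 hc
      obtain ⟨t, ht⟩ := hchild u (by simp)
      exact ⟨_, .one o u t ht⟩
    · obtain ⟨u, v, huv, rfl⟩ := Finset.card_eq_two.1 hc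
      obtain ⟨t₁, ht₁⟩ := hchild u (by simp)
      obtain ⟨t₂, ht₂⟩ := hchild v (by simp)
      exact ⟨_, by convert Binarizes.two o u v t₁ t₂ huv ht₁ ht₂⟩
  · obtain ⟨μ, hμ, hmax⟩ := C.exists_max_image (fun u : T => subtreeSize u)
      (Finset.card_pos.1 (by omega))
    obtain ⟨C₁, C₂, h1, h2, h3, h4, h5, h6⟩ := exists_balanced_split hge hμ hmax
    have hpos : 0 < ∑ u ∈ C, subtreeSize u :=
      Finset.sum_pos (fun u _ => subtreeSize_pos u) ⟨μ, hμ⟩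
    obtain ⟨t₁, ht₁⟩ := ih _ (by omega) none C₁ (fun h => absurd h h3.ne_empty) rfl
    obtain ⟨t₃, ht₃⟩ := ih _ (by omega) none C₂ (fun h => absurd h h4.ne_empty) rfl
    obtain ⟨t, ht⟩ := hchild μ hμ
    exact ⟨_, .many o C C₁ C₂ μ t₁ t t₃ hge hμ hmax h1 h2 h3 h4 h5 h6 ht₁ ht ht₃⟩

end Tree

section Tree

/-! ### The greedy cuts can be carried out -/

theorem BinTree.weight_pos {V : Type*} {w : V → ℝ} (hw : ∀ v, 0 < w v) :
    ∀ t : BinTree V, 0 < t.weight w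
  | .leaf v => hw v
  | .unary _ t => t.weight_pos hw
  | .binary _ l r => add_pos (l.weight_pos hw) (r.weight_pos hw)

variable {T : RootedTree} [Fintype T]

theorem sum_children_eq_weight {w : T → ℝ} (hw : IsProperlyWeighted w) {o : Option T}
    {C : Finset T} {t : BinTree T} (h : Binarizes o C t) :
    (C.Nonempty → t.weight w = ∑ u ∈ C, w u) ∧
      ∀ v, o = some v → C = children v → t.weight w = w v := by
  classical
  suffices hmain : (C.Nonempty → t.weight w = ∑ u ∈ C, w u) ∧ (C = ∅ → ∀ v, o = some v →
      t.weight w = w v) by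
    refine ⟨hmain.1, fun v ho hC => ?_⟩
    rcases C.eq_empty_or_nonempty with h0 | hne
    · exact hmain.2 h0 v ho
    · rw [hmain.1 hne, hC, hw.2.1 v (hC ▸ hne)]
  have key : ∀ {u : T} {t : BinTree T}, ((children u).Nonempty → t.weight w = ∑ x ∈ children u, w x) ∧
      (children u = ∅ → ∀ v, some u = some v → t.weight w = w v) → t.weight w = w u := by
    intro u t h
    rcases (children u).eq_empty_or_nonempty with h0 | hne
    · exact h.2 h0 u rfl
    · rw [h.1 hne, hw.2.1 u hne]
  induction h with
  | leaf v =>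
    refine ⟨fun h => absurd h (by simp), fun _ u hu => ?_⟩
    rw [Option.some.inj hu, BinTree.weight]
  | one o u t h ih =>
    refine ⟨fun _ => ?_, fun h => absurd h (by simp)⟩
    rw [BinTree.weight, key ih, Finset.sum_singleton]
  | two o u v t₁ t₂ huv h₁ h₂ ih₁ ih₂ =>
    refine ⟨fun _ => ?_, fun h => absurd h (by simp)⟩
    rw [BinTree.weight, key ih₁, key ih₂]
    convert (Finset.sum_pair huv).symm
  | many o C C₁ C₂ μ t₁ t t₃ hC hμ hmax hun hdis hC₁ hC₂ hs₁ hs₂ h₁ h h₃ ih₁ ih ih₃ =>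
    refine ⟨fun _ => ?_, fun h => absurd hμ (by simp [h])⟩
    rw [BinTree.weight, BinTree.weight, ih₁.1 hC₁, key ih, ih₃.1 hC₂]
    have h1 := Finset.sum_sdiff (s₁ := {μ}) (s₂ := C) (f := w) (by simpa using hμ)
    have h2 : ∑ u ∈ C \ {μ}, w u = ∑ u ∈ C₁, w u + ∑ u ∈ C₂, w u := by
      rw [← Finset.sum_union hdis]
      congr 1
      convert hun.symm
    rw [Finset.sum_singleton] at h1
    linarith

/-- The cuts constrain only the polygons of nodes occurring in the tree, so assignments on disjoint
subtrees can be glued. -/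
theorem GreedyCuts.congr {w : T → ℝ} {P P' : T → Set Plane} {o : Option T} {C : Finset T}
    {t : BinTree T} (h : Binarizes o C t) {R : Set Plane}
    (hPP : ∀ x, (o = some x ∨ ∃ u ∈ C, u ≤ x) → P' x = P x) (hg : GreedyCuts w P t R) :
    GreedyCuts w P' t R := by
  classical
  have key : ∀ {u x : T}, (some u = some x ∨ ∃ y ∈ children u, y ≤ x) → u ≤ x := by
    rintro u x (h | h)
    · exact (Option.some.inj h).le
    · exact le_iff_eq_or_exists_children.2 (Or.inr h)
  induction h generalizing R with
  | leaf v =>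
    rw [GreedyCuts] at hg ⊢
    rw [hPP v (Or.inl rfl), hg]
  | one o u t h ih =>
    obtain ⟨h1, h2⟩ := hg
    exact ⟨fun v hv => (hPP v (Or.inl hv)).trans (h1 v hv),
      ih (fun x hx => hPP x (Or.inr ⟨u, by simp, key hx⟩)) h2⟩
  | two o u v t₁ t₂ huv h₁ h₂ ih₁ ih₂ =>
    obtain ⟨h1, R₁, R₂, hcut, h2, h3⟩ := hg
    exact ⟨fun v hv => (hPP v (Or.inl hv)).trans (h1 v hv), R₁, R₂, hcut,
      ih₁ (fun x hx => hPP x (Or.inr ⟨u, by simp, key hx⟩)) h2,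
      ih₂ (fun x hx => hPP x (Or.inr ⟨v, by simp, key hx⟩)) h3⟩
  | many o C C₁ C₂ μ t₁ t t₃ hC hμ hmax hun hdis hC₁ hC₂ hs₁ hs₂ h₁ h h₃ ih₁ ih ih₃ =>
    obtain ⟨h1, R₁, R₂, hcut, h2, h3, R₃, R₄, hcut', h4, h5⟩ := hg
    have hsub : ∀ u ∈ C₁ ∪ C₂, u ∈ C := fun u hu => by
      rw [hun] at hu
      exact Finset.sdiff_subset hu
    have hnone : ∀ (D : Finset T), (∀ u ∈ D, u ∈ C) → ∀ x, (none = some x ∨ ∃ u ∈ D, u ≤ x) →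
        P' x = P x := by
      rintro D hD x (hx | ⟨u, hu, hux⟩)
      · simp at hx
      · exact hPP x (Or.inr ⟨u, hD u hu, hux⟩)
    exact ⟨fun v hv => (hPP v (Or.inl hv)).trans (h1 v hv), R₁, R₂, hcut,
      ih₁ (hnone C₁ fun u hu => hsub u (Finset.mem_union_left _ hu)) h2, by simp, R₃, R₄, hcut',
      ih (fun x hx => hPP x (Or.inr ⟨μ, hμ, key hx⟩)) h4,
      ih₃ (hnone C₂ fun u hu => hsub u (Finset.mem_union_right _ hu)) h5⟩

/-- `ν` is the original node whose children are being distributed; it is kept when passing to a new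
node. It ensures that the label `o` and the branches concern disjoint sets of nodes, so the pieces
glue. -/
theorem exists_greedyCuts {w : T → ℝ} (hw : ∀ v, 0 < w v) {o : Option T} {C : Finset T}
    {t : BinTree T} (h : Binarizes o C t) {ν : T} (hC : C ⊆ children ν) (ho : ∀ v, o = some v → v = ν)
    {R : Set Plane} (hR : IsConvexPolygon R) (ha : area R = t.weight w) :
    ∃ P : T → Set Plane, GreedyCuts w P t R := by
  classical
  have key : ∀ {u x : T}, (some u = some x ∨ ∃ y ∈ children u, y ≤ x) → u ≤ x := by
    rintro u x (h | h)
    · exact (Option.some.inj h).le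
    · exact le_iff_eq_or_exists_children.2 (Or.inr h)
  have hself : ∀ u v : T, some u = some v → v = u := fun u v h => (Option.some.inj h).symm
  have hcuts : ∀ {l r : BinTree T} {R : Set Plane}, IsConvexPolygon R →
      area R = l.weight w + r.weight w →
      ∃ R₁ R₂, IsGreedyCut R (l.weight w) (r.weight w) R₁ R₂ ∧ IsConvexPolygon R₁ ∧
        IsConvexPolygon R₂ ∧ area R₁ = l.weight w ∧ area R₂ = r.weight w := by
    intro l r R hR ha
    obtain ⟨R₁, R₂, hcut⟩ := exists_isGreedyCut hR.isCompact hR.convex (l.weight_pos hw)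
      (r.weight_pos hw) ha.symm
    obtain ⟨h1, h2⟩ := hcut.1.isConvexPolygon hR (l.weight_pos hw) (r.weight_pos hw)
    exact ⟨R₁, R₂, hcut, h1.1, h2.1, hcut.1.2⟩
  induction h generalizing R ν with
  | leaf v => exact ⟨fun _ => R, rfl⟩
  | one o u t h ih =>
    obtain ⟨P, hP⟩ := ih subset_rfl (hself u) hR ha
    have hu : ν ⋖ u := mem_children.1 (hC (by simp))
    refine ⟨fun x => if o = some x then R else P x, fun v hv => by simp [hv], ?_⟩
    refine hP.congr h fun x hx => if_neg fun hox => ?_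
    exact (hu.lt.trans_le (key hx)).ne' (ho x hox)
  | two o u v t₁ t₂ huv h₁ h₂ ih₁ ih₂ =>
    obtain ⟨R₁, R₂, hcut, hR₁, hR₂, ha₁, ha₂⟩ := hcuts hR ha
    obtain ⟨P₁, hP₁⟩ := ih₁ subset_rfl (hself u) hR₁ ha₁
    obtain ⟨P₂, hP₂⟩ := ih₂ subset_rfl (hself v) hR₂ ha₂
    have hu : ν ⋖ u := mem_children.1 (hC (by simp))
    have hv : ν ⋖ v := mem_children.1 (hC (by simp))
    refine ⟨fun x => if o = some x then R else if u ≤ x then P₁ x else P₂ x,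
      fun v hv => by simp [hv], R₁, R₂, hcut, hP₁.congr h₁ fun x hx => ?_,
      hP₂.congr h₂ fun x hx => ?_⟩
    · rw [if_neg fun hox => (hu.lt.trans_le (key hx)).ne' (ho x hox), if_pos (key hx)]
    · rw [if_neg fun hox => (hv.lt.trans_le (key hx)).ne' (ho x hox),
        if_neg fun hux => huv (eq_of_covBy_of_le hu hv hux (key hx))]
  | many o C C₁ C₂ μ t₁ t t₃ hcard hμ hmax hun hdis hC₁ hC₂ hs₁ hs₂ h₁ h h₃ ih₁ ih ih₃ =>
    have hmem : ∀ u, u ∈ C₁ ∪ C₂ → ν ⋖ u ∧ u ≠ μ := fun u hu => by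
      rw [hun, Finset.mem_sdiff, Finset.mem_singleton] at hu
      exact ⟨mem_children.1 (hC hu.1), hu.2⟩
    have hm₁ : ∀ u ∈ C₁, ν ⋖ u ∧ u ≠ μ := fun u hu => hmem u (Finset.mem_union_left _ hu)
    have hm₂ : ∀ u ∈ C₂, ν ⋖ u ∧ u ≠ μ := fun u hu => hmem u (Finset.mem_union_right _ hu)
    have hνμ : ν ⋖ μ := mem_children.1 (hC hμ)
    obtain ⟨R₁, R₂, hcut, hR₁, hR₂, ha₁, ha₂⟩ :=
      hcuts (l := t₁) (r := .binary none t t₃) hR ha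
    obtain ⟨R₃, R₄, hcut', hR₃, hR₄, ha₃, ha₄⟩ := hcuts (l := t) (r := t₃) hR₂ ha₂
    obtain ⟨P₁, hP₁⟩ := ih₁ (ν := ν) (fun u hu => mem_children.2 (hm₁ u hu).1) (by simp) hR₁ ha₁
    obtain ⟨P, hP⟩ := ih subset_rfl (hself μ) hR₃ ha₃
    obtain ⟨P₃, hP₃⟩ := ih₃ (ν := ν) (fun u hu => mem_children.2 (hm₂ u hu).1) (by simp) hR₄ ha₄
    refine ⟨fun x => if o = some x then R else if ∃ u ∈ C₁, u ≤ x then P₁ x else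
      if μ ≤ x then P x else P₃ x,
      fun v hv => by simp [hv], R₁, R₂, hcut, hP₁.congr h₁ ?_, by simp, R₃, R₄, hcut',
      hP.congr h fun x hx => ?_, hP₃.congr h₃ ?_⟩
    · rintro x (hx | ⟨u, hu, hux⟩)
      · simp at hx
      · rw [if_neg fun hox => ((hm₁ u hu).1.lt.trans_le hux).ne' (ho x hox), if_pos ⟨u, hu, hux⟩]
    · rw [if_neg fun hox => (hνμ.lt.trans_le (key hx)).ne' (ho x hox), if_neg, if_pos (key hx)]
      rintro ⟨u, hu, hux⟩
      exact (hm₁ u hu).2 (eq_of_covBy_of_le (hm₁ u hu).1 hνμ hux (key hx))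
    · rintro x (hx | ⟨u, hu, hux⟩)
      · simp at hx
      · rw [if_neg fun hox => ((hm₂ u hu).1.lt.trans_le hux).ne' (ho x hox), if_neg, if_neg]
        · exact fun hμx => (hm₂ u hu).2 (eq_of_covBy_of_le (hm₂ u hu).1 hνμ hux hμx)
        · rintro ⟨u', hu', hux'⟩
          have := eq_of_covBy_of_le (hm₂ u hu).1 (hm₁ u' hu').1 hux hux'
          exact Finset.disjoint_left.1 hdis hu' (this ▸ hu)

/-! ### Every outcome is a partition into fat polygons -/

/-- The requirements on a polygonal partition at the node `x`. -/
def IsPartitionAt (w : T → ℝ) (P : T → Set Plane) (x : T) : Prop :=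
  IsConvexPolygon (P x) ∧ area (P x) = w x ∧
  ((children x).Nonempty →
    P x = ⋃ μ ∈ children x, P μ ∧
    ∀ μ₁ ∈ children x, ∀ μ₂ ∈ children x, μ₁ ≠ μ₂ → Disjoint (interior (P μ₁)) (interior (P μ₂)))

/-- The polygons `P` of the nodes in `C` partition `R`, which is the polygon of the node `o`, and the
polygons below `C` form a polygonal partition whose aspect ratios at `x` are at most `B x ^ 8`. -/
structure Realizes (w : T → ℝ) (P : T → Set Plane) (o : Option T) (C : Finset T) (R : Set Plane)
    (B : T → ℕ) : Prop where
  label : ∀ v, o = some v → P v = R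
  cover : C.Nonempty → R = ⋃ u ∈ C, P u
  disjoint : ∀ u₁ ∈ C, ∀ u₂ ∈ C, u₁ ≠ u₂ → Disjoint (interior (P u₁)) (interior (P u₂))
  below : ∀ u ∈ C, ∀ x, u ≤ x → IsPartitionAt w P x ∧ aspectRatio (P x) ≤ (B x : ℝ) ^ 8

theorem Realizes.mono {w : T → ℝ} {P : T → Set Plane} {o : Option T} {C : Finset T}
    {R : Set Plane} {B B' : T → ℕ} (h : Realizes w P o C R B)
    (hB : ∀ u ∈ C, ∀ x, u ≤ x → B x ≤ B' x) : Realizes w P o C R B' :=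
  ⟨h.label, h.cover, h.disjoint, fun u hu x hx => ⟨(h.below u hu x hx).1,
    (h.below u hu x hx).2.trans (by gcongr; exact hB u hu x hx)⟩⟩

theorem Realizes.node {w : T → ℝ} {P : T → Set Plane} {u : T} {R : Set Plane} {B : T → ℕ} {k : ℕ}
    (h : Realizes w P (some u) (children u) R B) (hR : IsConvexPolygon R) (ha : area R = w u)
    (har : aspectRatio R ≤ (k : ℝ) ^ 8) (hB : k ≤ B u) (x : T) (hx : u ≤ x) :
    IsPartitionAt w P x ∧ aspectRatio (P x) ≤ (B x : ℝ) ^ 8 := by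
  rcases le_iff_eq_or_exists_children.1 hx with rfl | ⟨y, hy, hyx⟩
  · have hP := h.label x rfl
    rw [IsPartitionAt, hP]
    exact ⟨⟨hR, ha, fun hne => ⟨h.cover hne, h.disjoint⟩⟩, har.trans (by gcongr)⟩
  · exact h.below y hy x hyx

/-- The bound for the aspect ratio at `x` (without its exponent), if `x` lies below a node of level
`L` whose polygon has at most `k` vertices and whose proper subtrees have `S` nodes. -/
noncomputable def ratioBound (k L S : ℕ) (x : T) : ℕ := k + 2 * (level x - L) + 2 * Nat.log 2 S

theorem log_add_one_le {S' S : ℕ} (h' : 0 < S') (h : 2 * S' ≤ S) :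
    Nat.log 2 S' + 1 ≤ Nat.log 2 S := by
  rw [← Nat.log_mul_base (by norm_num) h'.ne', mul_comm]
  exact Nat.log_mono_right h

theorem sum_children_le {u : T} {C : Finset T} (hu : u ∈ C) :
    ∑ x ∈ children u, subtreeSize x ≤ ∑ x ∈ C, subtreeSize x := by
  have h1 := subtreeSize_eq u
  have h2 := Finset.single_le_sum (f := fun u : T => subtreeSize u) (fun _ _ => Nat.zero_le _) hu
  omega

/-- Induction along the binarization, with the vertex bound `k` growing by one per cut. `L` is the
level of the original node whose children are in `C`, so it stays fixed through new nodes. -/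
theorem realizes_of_greedyCuts {w : T → ℝ} (hw : IsProperlyWeighted w) {P : T → Set Plane}
    {o : Option T} {C : Finset T} {t : BinTree T} (h : Binarizes o C t) {L k : ℕ}
    (hL : ∀ u ∈ C, level u = L + 1) {R : Set Plane} (hR : IsConvexPolygon R)
    (ha : area R = t.weight w) (hk : numVertices R ≤ k) (har : aspectRatio R ≤ (k : ℝ) ^ 8)
    (hg : GreedyCuts w P t R) :
    Realizes w P o C R (ratioBound k L (∑ u ∈ C, subtreeSize u)) := by
  classical
  have hpos : ∀ t : BinTree T, 0 < t.weight w := fun t => t.weight_pos hw.1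
  have hlev : ∀ u : T, ∀ y ∈ children u, level y = level u + 1 := fun u y hy =>
    level_of_covBy (mem_children.1 hy)
  have hweight : ∀ {u : T} {t : BinTree T}, Binarizes (some u) (children u) t → t.weight w = w u :=
    fun h => (sum_children_eq_weight hw h).2 _ rfl rfl
  -- Stepping to an original child raises the level by one, and this pays for up to two cuts.
  have hbnd : ∀ {k k' L : ℕ} {C : Finset T} {u : T}, u ∈ C → level u = L + 1 → k' ≤ k + 2 →
      ∀ x, u ≤ x → ratioBound k' (level u) (∑ y ∈ children u, subtreeSize y) x ≤
        ratioBound k L (∑ y ∈ C, subtreeSize y) x := by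
    intro k k' L C u hu hLu hkk x hx
    have h1 := Nat.log_mono_right (b := 2) (sum_children_le hu)
    have h2 := level_mono hx
    rw [ratioBound, ratioBound]
    omega
  induction h generalizing L k R with
  | leaf v =>
    refine ⟨fun u hu => ?_, fun h => absurd h (by simp), by simp, by simp⟩
    rw [← Option.some.inj hu]
    exact hg
  | one o u t h ih =>
    obtain ⟨h1, h2⟩ := hg
    have ih' := ih (L := level u) (hlev u) hR ha hk har h2
    have hPu := ih'.label u rfl
    refine ⟨h1, fun _ => by simp [hPu], ?_, ?_⟩
    · intro u₁ hu₁ u₂ hu₂ hne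
      rw [Finset.mem_singleton] at hu₁ hu₂
      exact absurd (hu₁.trans hu₂.symm) hne
    · intro u' hu' x hx
      rw [Finset.mem_singleton] at hu'
      subst hu'
      obtain ⟨g1, g2⟩ := ih'.node hR (Eq.trans (b := t.weight w) ha (hweight h)) har
        (by rw [ratioBound]; omega) x hx
      refine ⟨g1, g2.trans ?_⟩
      gcongr
      exact hbnd (by simp) (hL u' (by simp)) (by omega) x hx
  | two o u v t₁ t₂ huv h₁ h₂ ih₁ ih₂ =>
    obtain ⟨h1, R₁, R₂, hcut, g1, g2⟩ := hg
    obtain ⟨⟨p1, n1, b1⟩, p2, n2, b2⟩ := hcut.bound hR hk har (hpos t₁) (hpos t₂) ha.symm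
    have i1 := ih₁ (L := level u) (hlev u) p1 hcut.1.2.1 n1 b1 g1
    have i2 := ih₂ (L := level v) (hlev v) p2 hcut.1.2.2 n2 b2 g2
    have hPu := i1.label u rfl
    have hPv := i2.label v rfl
    have hmem : ∀ x, x ∈ ({u, v} : Finset T) ↔ x = u ∨ x = v := by simp
    have hd := hcut.1.disjoint_interior
    rw [← hPu, ← hPv] at hd
    refine ⟨h1, fun _ => ?_, ?_, ?_⟩
    · rw [hcut.1.union_eq]
      ext y
      simp [hPu, hPv]
    · intro u₁ hu₁ u₂ hu₂ hne
      rcases (hmem u₁).1 (by convert hu₁) with rfl | rfl <;>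
        rcases (hmem u₂).1 (by convert hu₂) with rfl | rfl
      · exact absurd rfl hne
      · exact hd
      · exact hd.symm
      · exact absurd rfl hne
    · intro u' hu' x hx
      have hL' := hL u' hu'
      rcases (hmem u').1 (by convert hu') with rfl | rfl
      · obtain ⟨f1, f2⟩ := i1.node p1 (hcut.1.2.1.trans (hweight h₁)) b1
          (by rw [ratioBound]; omega) x hx
        refine ⟨f1, f2.trans ?_⟩
        gcongr
        exact hbnd hu' hL' (by omega) x hx
      · obtain ⟨f1, f2⟩ := i2.node p2 (hcut.1.2.2.trans (hweight h₂)) b2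
          (by rw [ratioBound]; omega) x hx
        refine ⟨f1, f2.trans ?_⟩
        gcongr
        exact hbnd hu' hL' (by omega) x hx
  | many o C C₁ C₂ μ t₁ t t₃ hcard hμ hmax hun hdis hC₁ hC₂ hs₁ hs₂ h₁ h h₃ ih₁ ih ih₃ =>
    obtain ⟨h1, R₁, R₂, hcut, g1, -, R₃, R₄, hcut', g3, g4⟩ := hg
    obtain ⟨⟨p1, n1, b1⟩, p2, n2, b2⟩ :=
      hcut.bound hR hk har (hpos t₁) (hpos (.binary none t t₃)) ha.symm
    obtain ⟨⟨p3, n3, b3⟩, p4, n4, b4⟩ := hcut'.bound p2 n2 b2 (hpos t) (hpos t₃) hcut.1.2.2.symm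
    have hmem : ∀ u, u ∈ C ↔ u = μ ∨ u ∈ C₁ ∨ u ∈ C₂ := by
      intro u
      rw [← Finset.mem_union, hun, Finset.mem_sdiff, Finset.mem_singleton]
      refine ⟨fun hu => ?_, ?_⟩
      · by_cases h : u = μ
        · exact Or.inl h
        · exact Or.inr ⟨hu, h⟩
      · rintro (rfl | hu)
        · exact hμ
        · exact hu.1
    have i1 := ih₁ (fun u hu => hL u ((hmem u).2 (by tauto))) p1 hcut.1.2.1 n1 b1 g1
    have i3 := ih (L := level μ) (hlev μ) p3 hcut'.1.2.1 n3 b3 g3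
    have i4 := ih₃ (fun u hu => hL u ((hmem u).2 (by tauto))) p4 hcut'.1.2.2 n4 b4 g4
    have hPμ := i3.label μ rfl
    have hsum_pos : ∀ {D : Finset T}, D.Nonempty → 0 < ∑ u ∈ D, subtreeSize u := fun hD =>
      Finset.sum_pos (fun u _ => subtreeSize_pos u) hD
    -- Each group contains at most half of the nodes counted by `S`, so `2 * Nat.log 2 S` drops by
    -- at least 2; this pays for the one cut leading to `C₁` or the two leading to `C₂`.
    have l1 := log_add_one_le (hsum_pos hC₁) (Nat.lt_succ_iff.1 (by rw [Nat.succ_eq_one_add]; exact hs₁))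
    have l2 := log_add_one_le (hsum_pos hC₂) (Nat.lt_succ_iff.1 (by rw [Nat.succ_eq_one_add]; exact hs₂))
    have i1 := i1.mono (B' := ratioBound k L (∑ u ∈ C, subtreeSize u)) fun u hu x hx => by
      rw [ratioBound, ratioBound]; omega
    have i4 := i4.mono (B' := ratioBound k L (∑ u ∈ C, subtreeSize u)) fun u hu x hx => by
      rw [ratioBound, ratioBound]; omega
    have c1 := i1.cover hC₁
    have c4 := i4.cover hC₂
    have s1 : ∀ u ∈ C₁, P u ⊆ R₁ := fun u hu => c1 ▸ subset_biUnion_of_mem (u := P) hu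
    have s4 : ∀ u ∈ C₂, P u ⊆ R₄ := fun u hu => c4 ▸ subset_biUnion_of_mem (u := P) hu
    have s34 := hcut'.1.union_eq
    have d12 := hcut.1.disjoint_interior
    have d34 := hcut'.1.disjoint_interior
    have dμ1 : ∀ u ∈ C₁, Disjoint (interior (P μ)) (interior (P u)) := fun u hu =>
      d12.symm.mono (interior_mono (by rw [hPμ, s34]; exact subset_union_left))
        (interior_mono (s1 u hu))
    have dμ2 : ∀ u ∈ C₂, Disjoint (interior (P μ)) (interior (P u)) := fun u hu =>
      d34.mono (interior_mono hPμ.le) (interior_mono (s4 u hu))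
    have d₁₂ : ∀ u ∈ C₁, ∀ v ∈ C₂, Disjoint (interior (P u)) (interior (P v)) := fun u hu v hv =>
      d12.mono (interior_mono (s1 u hu))
        (interior_mono ((s4 v hv).trans (by rw [s34]; exact subset_union_right)))
    refine ⟨h1, fun _ => ?_, ?_, ?_⟩
    · rw [hcut.1.union_eq, s34, c1, c4, ← hPμ]
      ext y
      simp only [mem_union, mem_iUnion, hmem, exists_prop, or_and_right, exists_or, exists_eq_left]
      exact or_left_comm
    · intro u₁ hu₁ u₂ hu₂ hne
      rcases (hmem u₁).1 hu₁ with rfl | e₁ | e₁ <;> rcases (hmem u₂).1 hu₂ with rfl | e₂ | e₂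
      · exact absurd rfl hne
      · exact dμ1 _ e₂
      · exact dμ2 _ e₂
      · exact (dμ1 _ e₁).symm
      · exact i1.disjoint _ e₁ _ e₂ hne
      · exact d₁₂ _ e₁ _ e₂
      · exact (dμ2 _ e₁).symm
      · exact (d₁₂ _ e₂ _ e₁).symm
      · exact i4.disjoint _ e₁ _ e₂ hne
    · intro u hu x hx
      rcases (hmem u).1 hu with rfl | e | e
      · obtain ⟨f1, f2⟩ := i3.node p3 (hcut'.1.2.1.trans (hweight h)) b3
          (by rw [ratioBound]; omega) x hx
        refine ⟨f1, f2.trans ?_⟩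
        gcongr
        exact hbnd hu (hL u hu) (by omega) x hx
      · exact i1.below u e x hx
      · exact i4.below u e x hx

end Tree

/-! ### The bound for trees, starting from the unit square. -/

theorem IsGreedyOutcome.isPartitionAt {T : RootedTree} [Fintype T] {w : T → ℝ}
    (hw : IsProperlyWeighted w) {P : T → Set Plane} (hP : IsGreedyOutcome w P) :
    P ⊥ = unitSquare ∧ ∀ x : T, IsPartitionAt w P x ∧
      aspectRatio (P x) ≤ (ratioBound 4 0 (Fintype.card T) x : ℝ) ^ 8 := by
  obtain ⟨t, ht, hg⟩ := hP
  have hwt := (sum_children_eq_weight hw ht).2 _ rfl rfl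
  have ha : area unitSquare = t.weight w := by rw [area_unitSquare, hwt, hw.2.2]
  have h := realizes_of_greedyCuts hw ht (L := 0)
    (fun u hu => by rw [level_of_covBy (mem_children.1 hu), level_bot])
    isConvexPolygon_unitSquare ha numVertices_unitSquare_le aspectRatio_unitSquare_le hg
  refine ⟨h.label ⊥ rfl, fun x => ?_⟩
  obtain ⟨h1, h2⟩ := h.node isConvexPolygon_unitSquare (ha.trans hwt) aspectRatio_unitSquare_le
    (by rw [ratioBound]; omega) x bot_le
  refine ⟨h1, h2.trans ?_⟩
  have h3 : ∑ u ∈ children (⊥ : T), subtreeSize u ≤ Fintype.card T := by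
    have := subtreeSize_eq (⊥ : T)
    have := subtreeSize_le_card (⊥ : T)
    omega
  gcongr
  have := Nat.log_mono_right (b := 2) h3
  rw [ratioBound, ratioBound]
  omega

theorem exists_isGreedyOutcome {T : RootedTree} [Fintype T] {w : T → ℝ}
    (hw : IsProperlyWeighted w) : ∃ P : T → Set Plane, IsGreedyOutcome w P := by
  obtain ⟨t, ht⟩ := exists_binarizes _ (some (⊥ : T)) (children ⊥) (fun _ => ⟨⊥, rfl⟩) rfl
  obtain ⟨P, hP⟩ := exists_greedyCuts hw.1 ht subset_rfl (fun v hv => (Option.some.inj hv).symm)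
    isConvexPolygon_unitSquare
    (by rw [area_unitSquare, (sum_children_eq_weight hw ht).2 _ rfl rfl, hw.2.2])
  exact ⟨P, t, ht, hP⟩

/-- The initial `4`, the vertices of the square, is absorbed by `4 log₂ n`, as `n ≥ 2`. -/
theorem ratioBound_le {T : RootedTree} [Fintype T] (hn : 2 ≤ Fintype.card T) (x : T) :
    (ratioBound 4 0 (Fintype.card T) x : ℝ) ≤
      6 * ((depth T : ℝ) + Real.logb 2 (Fintype.card T)) := by
  have h1 : ((Nat.log 2 (Fintype.card T) : ℕ) : ℝ) ≤ Real.logb 2 (Fintype.card T) :=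
    Real.natLog_le_logb _ _
  have h2 : (level x : ℝ) ≤ depth T := by exact_mod_cast level_le_depth x
  have h3 : 1 ≤ Real.logb 2 (Fintype.card T) := by
    rw [Real.le_logb_iff_rpow_le (by norm_num) (by positivity), Real.rpow_one]
    exact_mod_cast hn
  have h4 : (0 : ℝ) ≤ level x := Nat.cast_nonneg _
  rw [ratioBound, Nat.sub_zero]
  push_cast
  linarith

end FatPartition

theorem mainTheorem2 :
    (∃ C : ℝ, ∀ (T : RootedTree) [Fintype T] (w : T → ℝ),
      2 ≤ Fintype.card T → FatPartition.IsProperlyWeighted w →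
        (∃ P : T → Set FatPartition.Plane, FatPartition.IsGreedyOutcome w P) ∧
        ∀ P : T → Set FatPartition.Plane, FatPartition.IsGreedyOutcome w P →
          FatPartition.IsPolygonalPartition w P ∧
          ∀ ν : T, FatPartition.aspectRatio (P ν) ≤
            C * ((FatPartition.depth T : ℝ) + Real.logb 2 (Fintype.card T : ℝ)) ^ 8) ∧
    (∀ (k : ℕ) (P : Set FatPartition.Plane) (a : ℝ),
      FatPartition.IsConvexPolygon P → FatPartition.numVertices P = k → 0 < a → a ≤ 1 / 2 →
        ∃ P₁ P₂ : Set FatPartition.Plane,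
          FatPartition.IsCut P (a * FatPartition.area P) ((1 - a) * FatPartition.area P) P₁ P₂ ∧
          FatPartition.IsConvexPolygon P₁ ∧ FatPartition.IsConvexPolygon P₂ ∧
          FatPartition.numVertices P₁ ≤ k + 1 ∧ FatPartition.numVertices P₂ ≤ k + 1 ∧
          max (FatPartition.aspectRatio P₁) (FatPartition.aspectRatio P₂) ≤
            max (FatPartition.aspectRatio P * (1 + 6 / (k : ℝ))) ((k : ℝ) ^ 8)) := by
  refine ⟨⟨6 ^ 8, fun T _ w hn hw => ⟨FatPartition.exists_isGreedyOutcome hw, fun P hP => ?_⟩⟩, ?_⟩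
  · obtain ⟨hroot, hx⟩ := hP.isPartitionAt hw
    refine ⟨⟨fun ν => (hx ν).1.1, hroot, fun ν => (hx ν).1.2.1, fun ν => (hx ν).1.2.2⟩, fun ν => ?_⟩
    refine (hx ν).2.trans ?_
    rw [← mul_pow]
    gcongr
    exact FatPartition.ratioBound_le hn ν
  · intro k P a hP hk ha ha2
    obtain ⟨P₁, P₂, hcut, hb⟩ := FatPartition.exists_good_cut hP
      (hk ▸ hP.three_le_numVertices) hk.le ha ha2
    have hA := hP.area_pos
    obtain ⟨⟨p1, n1⟩, p2, n2⟩ := hcut.isConvexPolygon hP (mul_pos ha hA)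
      (mul_pos (by linarith) hA)
    exact ⟨P₁, P₂, hcut, p1, p2, hk ▸ n1, hk ▸ n2, hb⟩
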